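/- Let $\mathcal V=(\mathcal V_0,\otimes,I)$ be a symmetric monoidal closed category with $\mathcal V_0$ complete and cocomplete, and let $J:\mathcal A\to\mathcal B$ be a $\mathcal V$-functor between small $\mathcal V$-categories. For a small $\mathcal V$-category $\mathcal D$ and a $\mathcal V$-category $\mathcal C$, let $[\mathcal D,\mathcal C]$ denote the $\mathcal V$-category of $\mathcal V$-functors $\mathcal D\to\mathcal C$, with hom-objects the ends $[\mathcal D,\mathcal C](F,G)=\int_{D\in\mathcal D}\mathcal C(FD,GD)$. Then the following conditions are equivalent. (a) $J$ is a $\mathcal V$-lax epimorphism: for every small $\mathcal V$-category $\mathcal C$, the precomposition $\mathcal V$-functor $[J,\mathcal C]:[\mathcal B,\mathcal C]\to[\mathcal A,\mathcal C]$ is $\mathcal V$-fully faithful, i.e. for all $\mathcal V$-functors $F,G:\mathcal B\to\mathcal C$ the morphism $[\mathcal B,\mathcal C](F,G)\to[\mathcal A,\mathcal C](FJ,GJ)$ is an isomorphism in $\mathcal V_0$. (b) $J$ is absolutely $\mathcal V$-dense: the (pointwise) left Kan extension $\mathrm{Lan}_J J$ exists and is $\mathcal V$-naturally isomorphic to the identity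 of $\mathcal B$ (that is, $J$ is $\mathcal V$-dense), and $\mathrm{Lan}_J J$ is preserved by every $\mathcal V$-functor $F:\mathcal B\to\mathcal V$. (c) $J$ is absolutely $\mathcal V$-codense: the (pointwise) right Kan extension $\mathrm{Ran}_J J$ exists and is $\mathcal V$-naturally isomorphic to the identity of $\mathcal B$ (that is, $J$ is $\mathcal V$-codense), and $\mathrm{Ran}_J J$ is preserved by every $\mathcal V$-functor $F:\mathcal B\to\mathcal V$. -/

import Mathlib

open CategoryTheory MonoidalCategory Limits
open scoped MonoidalClosed

/- With all of Mathlib imported, `X ⟶ Y` would otherwise elaborate through reflexive quivers. -/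
attribute [-instance] CategoryTheory.catToReflQuiver

universe u v w₁ w₂ w₃ w₄

set_option linter.unusedSectionVars false

noncomputable section

namespace VCat

variable {V : Type v} [Category.{u} V] [MonoidalCategory V]

/-- `V`-natural transformations: families `I ⟶ C(F a, G a)` making the usual hexagon commute.
(Mathlib has `EnrichedNatTrans`, but it only asks for naturality of the underlying functors.) -/
structure VNatTrans {A : Type w₁} [EnrichedCategory V A] {C : Type w₂} [EnrichedCategory V C]
    (F G : EnrichedFunctor V A C) where
  app (a : A) : 𝟙_ V ⟶ (F.obj a ⟶[V] G.obj a)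
  naturality (a a' : A) :
    (ρ_ (a ⟶[V] a')).inv ≫ (F.map a a' ⊗ₘ app a') ≫ eComp V _ _ _ =
      (λ_ (a ⟶[V] a')).inv ≫ (app a ⊗ₘ G.map a a') ≫ eComp V _ _ _

/-- The whiskering `F η : F G ⟶ (F L) J` of `η : G ⟶ L J` with a `V`-functor `F`. -/
def VNatTrans.whiskerUnit {A : Type w₁} [EnrichedCategory V A] {B : Type w₂}
    [EnrichedCategory V B] {C : Type w₃} [EnrichedCategory V C] {D : Type w₄}
    [EnrichedCategory V D]
    {J : EnrichedFunctor V A B} {G : EnrichedFunctor V A C} {L : EnrichedFunctor V B C}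
    (η : VNatTrans G (J.comp V L)) (F : EnrichedFunctor V C D) :
    VNatTrans (G.comp V F) (J.comp V (L.comp V F)) where
  app a := η.app a ≫ F.map (G.obj a) (L.obj (J.obj a))
  naturality a a' := by
    have h := η.naturality a a' =≫ F.map _ _
    simp only [Category.assoc, EnrichedFunctor.map_comp] at h
    dsimp only [EnrichedFunctor.comp] at h ⊢
    simp only [tensorHom_comp_tensorHom_assoc, Category.assoc] at h
    exact h

/-- The whiskering `F ε : (F R) J ⟶ F G` of `ε : R J ⟶ G` with a `V`-functor `F`. -/
def VNatTrans.whiskerCounit {A : Type w₁} [EnrichedCategory V A] {B : Type w₂}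
    [EnrichedCategory V B] {C : Type w₃} [EnrichedCategory V C] {D : Type w₄}
    [EnrichedCategory V D]
    {J : EnrichedFunctor V A B} {G : EnrichedFunctor V A C} {R : EnrichedFunctor V B C}
    (ε : VNatTrans (J.comp V R) G) (F : EnrichedFunctor V C D) :
    VNatTrans (J.comp V (R.comp V F)) (G.comp V F) where
  app a := ε.app a ≫ F.map (R.obj (J.obj a)) (G.obj a)
  naturality a a' := by
    have h := ε.naturality a a' =≫ F.map _ _
    simp only [Category.assoc, EnrichedFunctor.map_comp] at h
    dsimp only [EnrichedFunctor.comp] at h ⊢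
    simp only [tensorHom_comp_tensorHom_assoc, Category.assoc] at h
    exact h

/-- A `V`-natural transformation is a `V`-natural isomorphism if it has a `V`-natural inverse. -/
def IsNatIso {A : Type w₁} [EnrichedCategory V A] {C : Type w₂} [EnrichedCategory V C]
    {F G : EnrichedFunctor V A C} (α : VNatTrans F G) : Prop :=
  ∃ β : VNatTrans G F, ∀ a : A,
    (λ_ (𝟙_ V)).inv ≫ (α.app a ⊗ₘ β.app a) ≫ eComp V _ _ _ = eId V (F.obj a) ∧
    (λ_ (𝟙_ V)).inv ≫ (β.app a ⊗ₘ α.app a) ≫ eComp V _ _ _ = eId V (G.obj a)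

variable [SymmetricCategory V]

/-- The opposite `V`-functor. -/
def opFunctor {A : Type w₁} [EnrichedCategory V A] {C : Type w₂} [EnrichedCategory V C]
    (F : EnrichedFunctor V A C) : EnrichedFunctor V Aᵒᵖ Cᵒᵖ where
  obj a := Opposite.op (F.obj a.unop)
  map a a' := F.map a'.unop a.unop
  map_id a := F.map_id a.unop
  map_comp a a' a'' := by
    rw [eComp_op_eq, tensorHom_eComp_op_eq, Category.assoc]
    exact congrArg _ (F.map_comp a''.unop a'.unop a.unop)

theorem braid_aux {P Q R : V} (f : 𝟙_ V ⟶ P) (g : R ⟶ Q) {S : V} (c : P ⊗ Q ⟶ S) :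
    (ρ_ R).inv ≫ (g ⊗ₘ f) ≫ (β_ Q P).hom ≫ c = (λ_ R).inv ≫ (f ⊗ₘ g) ≫ c := by
  rw [BraidedCategory.braiding_naturality_assoc, rightUnitor_inv_braiding_assoc]

theorem braid_aux' {P Q R : V} (f : 𝟙_ V ⟶ P) (g : R ⟶ Q) {S : V} (c : Q ⊗ P ⟶ S) :
    (λ_ R).inv ≫ (f ⊗ₘ g) ≫ (β_ P Q).hom ≫ c = (ρ_ R).inv ≫ (g ⊗ₘ f) ≫ c := by
  rw [BraidedCategory.braiding_naturality_assoc, leftUnitor_inv_braiding_assoc]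

/-- The opposite `V`-natural transformation. -/
def opNatTrans {A : Type w₁} [EnrichedCategory V A] {C : Type w₂} [EnrichedCategory V C]
    {F G : EnrichedFunctor V A C} (α : VNatTrans F G) :
    VNatTrans (opFunctor G) (opFunctor F) where
  app a := α.app a.unop
  naturality a a' :=
    (braid_aux (α.app a'.unop) (G.map a'.unop a.unop) (eComp V _ _ _)).trans
      ((α.naturality a'.unop a.unop).symm.trans
        (braid_aux' (α.app a.unop) (F.map a'.unop a.unop) (eComp V _ _ _)).symm)

section Wedge

variable {A : Type w₁} [EnrichedCategory V A] {C : Type w₂} [EnrichedCategory V C]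

/-- A family `k a : X ⟶ C(F a, G a)` is `V`-natural in `a` (a wedge for the end of `C(F a, G a)`):
the two induced morphisms `X ⊗ A(a, a') ⟶ C(F a, G a')` agree. -/
def IsWedge (F G : EnrichedFunctor V A C) {X : V} (k : ∀ a, X ⟶ (F.obj a ⟶[V] G.obj a)) : Prop :=
  ∀ a a' : A, (β_ X (a ⟶[V] a')).hom ≫ (F.map a a' ⊗ₘ k a') ≫ eComp V _ _ _ =
    (k a ⊗ₘ G.map a a') ≫ eComp V _ _ _

theorem IsWedge.precomp {F G : EnrichedFunctor V A C} {X Y : V}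
    {k : ∀ a, X ⟶ (F.obj a ⟶[V] G.obj a)} (hk : IsWedge F G k) (f : Y ⟶ X) :
    IsWedge F G (fun a => f ≫ k a) := by
  intro a a'
  have h := (f ▷ (a ⟶[V] a')) ≫= hk a a'
  rw [BraidedCategory.braiding_naturality_left_assoc] at h
  simpa [MonoidalCategory.tensorHom_def, whisker_exchange_assoc] using h

theorem IsWedge.restrict {B : Type w₃} [EnrichedCategory V B] {F G : EnrichedFunctor V A C} {X : V}
    {k : ∀ a, X ⟶ (F.obj a ⟶[V] G.obj a)} (hk : IsWedge F G k) (J : EnrichedFunctor V B A) :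
    IsWedge (J.comp V F) (J.comp V G) (fun b => k (J.obj b)) := by
  intro b b'
  have h := (X ◁ J.map b b') ≫= hk (J.obj b) (J.obj b')
  rw [BraidedCategory.braiding_naturality_right_assoc, whiskerRight_comp_tensorHom_assoc,
    whiskerLeft_comp_tensorHom_assoc] at h
  exact h

theorem IsWedge.id (F : EnrichedFunctor V A C) : IsWedge F F (fun a => eId V (F.obj a)) := by
  intro a a'
  have h1 : (F.map a a' ⊗ₘ eId V (F.obj a')) ≫ eComp V _ _ _ = (ρ_ _).hom ≫ F.map a a' := by
    rw [← cancel_epi (ρ_ _).inv]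
    simp [MonoidalCategory.tensorHom_def]
  have h2 : (eId V (F.obj a) ⊗ₘ F.map a a') ≫ eComp V _ _ _ = (λ_ _).hom ≫ F.map a a' := by
    rw [← cancel_epi (λ_ _).inv]
    simp [MonoidalCategory.tensorHom_def']
  rw [h1, h2]
  simp

theorem eComp_tensor_assoc {P Q R : V} {w x y z : C} (f : P ⟶ (w ⟶[V] x)) (g : Q ⟶ (x ⟶[V] y))
    (h : R ⟶ (y ⟶[V] z)) :
    (f ⊗ₘ ((g ⊗ₘ h) ≫ eComp V x y z)) ≫ eComp V w x z =
      (α_ P Q R).inv ≫ (((f ⊗ₘ g) ≫ eComp V w x y) ⊗ₘ h) ≫ eComp V w y z := by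
  have e1 : f ⊗ₘ ((g ⊗ₘ h) ≫ eComp V x y z) = (f ⊗ₘ (g ⊗ₘ h)) ≫ (_ ◁ eComp V x y z) :=
    (tensorHom_comp_whiskerLeft _ _ _).symm
  have e2 : ((f ⊗ₘ g) ≫ eComp V w x y) ⊗ₘ h = ((f ⊗ₘ g) ⊗ₘ h) ≫ (eComp V w x y ▷ _) :=
    (tensorHom_comp_whiskerRight _ _ _).symm
  rw [e1, e2, Category.assoc, Category.assoc, ← e_assoc, associator_inv_naturality_assoc]

theorem IsWedge.comp {F G H : EnrichedFunctor V A C} {X Y : V}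
    {k : ∀ a, X ⟶ (F.obj a ⟶[V] G.obj a)} (hk : IsWedge F G k)
    {l : ∀ a, Y ⟶ (G.obj a ⟶[V] H.obj a)} (hl : IsWedge G H l) :
    IsWedge F H (fun a => (k a ⊗ₘ l a) ≫ eComp V _ _ _) := by
  intro a a'
  have e4 : ((β_ X (a ⟶[V] a')).hom ▷ Y) ≫
      (((F.map a a' ⊗ₘ k a') ≫ eComp V _ _ _) ⊗ₘ l a') ≫ eComp V _ _ _ =
      (((k a ⊗ₘ G.map a a') ≫ eComp V _ _ _) ⊗ₘ l a') ≫ eComp V _ _ _ := by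
    rw [← hk a a', ← Category.assoc, whiskerRight_comp_tensorHom]
  have e5 : (X ◁ (β_ Y (a ⟶[V] a')).hom) ≫
      (k a ⊗ₘ ((G.map a a' ⊗ₘ l a') ≫ eComp V _ _ _)) ≫ eComp V _ _ _ =
      (k a ⊗ₘ ((l a ⊗ₘ H.map a a') ≫ eComp V _ _ _)) ≫ eComp V _ _ _ := by
    rw [← hl a a', ← Category.assoc, whiskerLeft_comp_tensorHom]
  rw [eComp_tensor_assoc, BraidedCategory.braiding_tensor_left_hom]
  simp only [Category.assoc, Iso.hom_inv_id_assoc]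
  rw [e4]
  rw [eComp_tensor_assoc, eComp_tensor_assoc] at e5
  rw [e5, Iso.hom_inv_id_assoc]

end Wedge

variable [MonoidalClosed V]

theorem uncurry_comp_aux {X Y Z : V} {P Q : V} (f : P ⟶ (ihom X).obj Y) (g : Q ⟶ (ihom Y).obj Z) :
    MonoidalClosed.uncurry ((f ⊗ₘ g) ≫ eComp V X Y Z) =
      (α_ X P Q).inv ≫ MonoidalClosed.uncurry f ▷ Q ≫ MonoidalClosed.uncurry g := by
  rw [MonoidalClosed.enrichedCategorySelf_comp, MonoidalClosed.uncurry_natural_left,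
    MonoidalClosed.comp_eq, MonoidalClosed.uncurry_curry, MonoidalClosed.compTranspose_eq,
    MonoidalClosed.uncurry_eq f, MonoidalClosed.uncurry_eq g, MonoidalCategory.tensorHom_def,
    MonoidalCategory.whiskerLeft_comp, Category.assoc, associator_inv_naturality_right_assoc,
    whisker_exchange_assoc, associator_inv_naturality_middle_assoc, comp_whiskerRight,
    Category.assoc]
  rfl

/-- The covariant representable `V`-functor `C(c, -) : C → V`. -/
def corep {C : Type w₁} [EnrichedCategory V C] (c : C) : EnrichedFunctor V C V where
  obj x := c ⟶[V] x
  map x y := MonoidalClosed.curry (eComp V c x y)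
  map_id x := by
    rw [MonoidalClosed.enrichedCategorySelf_id, MonoidalClosed.id_eq]
    apply MonoidalClosed.uncurry_injective
    rw [MonoidalClosed.uncurry_natural_left]
    simp only [MonoidalClosed.uncurry_curry]
    rw [← cancel_epi (ρ_ _).inv]
    simp
  map_comp x y z := by
    apply MonoidalClosed.uncurry_injective
    rw [uncurry_comp_aux, MonoidalClosed.uncurry_natural_left]
    simp only [MonoidalClosed.uncurry_curry]
    exact (e_assoc V c x y z).symm


section Hom

theorem curry_wedge_iff {X H P Q R S : V} (f : H ⟶ P) (k' : X ⟶ Q) (k : X ⟶ R) (g : H ⟶ S) {T : V}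
    (c : P ⊗ Q ⟶ T) (d : R ⊗ S ⟶ T) :
    k ≫ MonoidalClosed.curry ((β_ H R).hom ≫ (_ ◁ g) ≫ d) =
      k' ≫ MonoidalClosed.curry ((f ▷ _) ≫ c) ↔
    (β_ X H).hom ≫ (f ⊗ₘ k') ≫ c = (k ⊗ₘ g) ≫ d := by
  rw [← MonoidalClosed.curry_natural_left, ← MonoidalClosed.curry_natural_left,
    MonoidalClosed.curry_injective.eq_iff, ← cancel_epi (β_ X H).hom]
  simp only [MonoidalCategory.tensorHom_def, Category.assoc,
    BraidedCategory.braiding_naturality_right_assoc]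
  rw [SymmetricCategory.symmetry_assoc, whisker_exchange_assoc]
  exact eq_comm

variable [HasLimits V] {A : Type u} [EnrichedCategory V A] {C : Type w₂} [EnrichedCategory V C]

/-- First of the two maps whose equalizer is the end `∫ a, C(F a, G a)`, induced by `G`. -/
def natHomFst (F G : EnrichedFunctor V A C) :
    (∏ᶜ fun a : A => (F.obj a ⟶[V] G.obj a)) ⟶
      ∏ᶜ fun p : A × A => (ihom (p.1 ⟶[V] p.2)).obj (F.obj p.1 ⟶[V] G.obj p.2) :=
  Pi.lift fun p => Pi.π _ p.1 ≫
    MonoidalClosed.curry ((β_ (p.1 ⟶[V] p.2) (F.obj p.1 ⟶[V] G.obj p.1)).hom ≫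
      (_ ◁ G.map p.1 p.2) ≫ eComp V (F.obj p.1) (G.obj p.1) (G.obj p.2))

/-- Second of the two maps whose equalizer is the end `∫ a, C(F a, G a)`, induced by `F`. -/
def natHomSnd (F G : EnrichedFunctor V A C) :
    (∏ᶜ fun a : A => (F.obj a ⟶[V] G.obj a)) ⟶
      ∏ᶜ fun p : A × A => (ihom (p.1 ⟶[V] p.2)).obj (F.obj p.1 ⟶[V] G.obj p.2) :=
  Pi.lift fun p => Pi.π _ p.2 ≫
    MonoidalClosed.curry ((F.map p.1 p.2 ▷ _) ≫ eComp V (F.obj p.1) (F.obj p.2) (G.obj p.2))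

/-- The end `∫ a, C(F a, G a)`, the equalizer of
`∏ a, C(F a, G a) ⇉ ∏ (a, a'), [A(a, a'), C(F a, G a')]`. -/
def natHom (F G : EnrichedFunctor V A C) : V :=
  equalizer (natHomFst F G) (natHomSnd F G)

/-- The projections of the end. -/
def natHomπ (F G : EnrichedFunctor V A C) (a : A) : natHom F G ⟶ (F.obj a ⟶[V] G.obj a) :=
  equalizer.ι (natHomFst F G) (natHomSnd F G) ≫ Pi.π _ a

theorem comp_natHomFst (F G : EnrichedFunctor V A C) {X : V}
    (f : X ⟶ ∏ᶜ fun a : A => (F.obj a ⟶[V] G.obj a)) (p : A × A) :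
    (f ≫ natHomFst F G) ≫ Pi.π _ p = (f ≫ Pi.π _ p.1) ≫
      MonoidalClosed.curry ((β_ (p.1 ⟶[V] p.2) (F.obj p.1 ⟶[V] G.obj p.1)).hom ≫
        (_ ◁ G.map p.1 p.2) ≫ eComp V (F.obj p.1) (G.obj p.1) (G.obj p.2)) := by
  rw [Category.assoc, Category.assoc, natHomFst]
  exact congrArg (f ≫ ·) (limit.lift_π _ _)

theorem comp_natHomSnd (F G : EnrichedFunctor V A C) {X : V}
    (f : X ⟶ ∏ᶜ fun a : A => (F.obj a ⟶[V] G.obj a)) (p : A × A) :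
    (f ≫ natHomSnd F G) ≫ Pi.π _ p = (f ≫ Pi.π _ p.2) ≫
      MonoidalClosed.curry ((F.map p.1 p.2 ▷ _) ≫
        eComp V (F.obj p.1) (F.obj p.2) (G.obj p.2)) := by
  rw [Category.assoc, Category.assoc, natHomSnd]
  exact congrArg (f ≫ ·) (limit.lift_π _ _)

theorem natHom_ext {F G : EnrichedFunctor V A C} {X : V} {f g : X ⟶ natHom F G}
    (h : ∀ a, f ≫ natHomπ F G a = g ≫ natHomπ F G a) : f = g := by
  apply equalizer.hom_ext
  apply Pi.hom_ext
  intro a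
  exact (Category.assoc _ _ _).trans ((h a).trans (Category.assoc _ _ _).symm)

theorem natHomπ_isWedge (F G : EnrichedFunctor V A C) : IsWedge F G (natHomπ F G) := by
  intro a a'
  rw [← curry_wedge_iff]
  have h := equalizer.condition (natHomFst F G) (natHomSnd F G) =≫ Pi.π _ (a, a')
  rw [comp_natHomFst, comp_natHomSnd] at h
  exact h

/-- The morphism into the end induced by a wedge. -/
def natHomLift {F G : EnrichedFunctor V A C} {X : V} (k : ∀ a, X ⟶ (F.obj a ⟶[V] G.obj a))
    (hk : IsWedge F G k) : X ⟶ natHom F G :=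
  equalizer.lift (f := natHomFst F G) (g := natHomSnd F G) (Pi.lift k) (by
    apply Pi.hom_ext
    rintro ⟨a, a'⟩
    rw [comp_natHomFst, comp_natHomSnd]
    have h (a : A) : Pi.lift k ≫ Pi.π _ a = k a := limit.lift_π _ _
    rw [h, h]
    exact (curry_wedge_iff _ _ _ _ _ _).2 (hk a a'))

theorem natHomLift_π {F G : EnrichedFunctor V A C} {X : V}
    (k : ∀ a, X ⟶ (F.obj a ⟶[V] G.obj a)) (hk : IsWedge F G k) (a : A) :
    natHomLift k hk ≫ natHomπ F G a = k a :=
  (Category.assoc _ _ _).symm.trans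
    ((congrArg (· ≫ Pi.π _ a) (equalizer.lift_ι _ _)).trans (limit.lift_π _ _))

/-- The `V`-category `[A, C]` of `V`-functors, for small `A`. -/
instance functorCategory : EnrichedCategory V (EnrichedFunctor V A C) where
  Hom F G := natHom F G
  id F := natHomLift (fun a => eId V (F.obj a)) (IsWedge.id F)
  comp F G H := natHomLift (fun a => (natHomπ F G a ⊗ₘ natHomπ G H a) ≫ eComp V _ _ _)
    ((natHomπ_isWedge F G).comp (natHomπ_isWedge G H))
  id_comp F G := by
    apply natHom_ext
    intro a
    simp only [Category.assoc, natHomLift_π, Category.id_comp]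
    rw [whiskerRight_comp_tensorHom_assoc, natHomLift_π, MonoidalCategory.tensorHom_def',
      Category.assoc, ← leftUnitor_inv_naturality_assoc, e_id_comp, Category.comp_id]
  comp_id F G := by
    apply natHom_ext
    intro a
    simp only [Category.assoc, natHomLift_π, Category.id_comp]
    rw [whiskerLeft_comp_tensorHom_assoc, natHomLift_π, MonoidalCategory.tensorHom_def,
      Category.assoc, ← rightUnitor_inv_naturality_assoc, e_comp_id, Category.comp_id]
  assoc F G H K := by
    apply natHom_ext
    intro a
    simp only [Category.assoc, natHomLift_π]
    rw [whiskerLeft_comp_tensorHom_assoc, whiskerRight_comp_tensorHom_assoc, natHomLift_π,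
      natHomLift_π, eComp_tensor_assoc]

theorem functorCategory_id_π (F : EnrichedFunctor V A C) (a : A) :
    eId V F ≫ natHomπ F F a = eId V (F.obj a) :=
  natHomLift_π _ (IsWedge.id F) a

theorem functorCategory_comp_π (F G H : EnrichedFunctor V A C) (a : A) :
    eComp V F G H ≫ natHomπ F H a =
      (natHomπ F G a ⊗ₘ natHomπ G H a) ≫ eComp V (F.obj a) (G.obj a) (H.obj a) :=
  natHomLift_π _ ((natHomπ_isWedge F G).comp (natHomπ_isWedge G H)) a

variable {B : Type u} [EnrichedCategory V B]

/-- The action of `[J, C] : [B, C] → [A, C]` on hom-objects. -/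
def restrict (J : EnrichedFunctor V A B) (F G : EnrichedFunctor V B C) :
    natHom F G ⟶ natHom (J.comp V F) (J.comp V G) :=
  natHomLift (F := J.comp V F) (G := J.comp V G) (fun a => natHomπ F G (J.obj a))
    ((natHomπ_isWedge F G).restrict J)

theorem restrict_π (J : EnrichedFunctor V A B) (F G : EnrichedFunctor V B C) (a : A) :
    restrict J F G ≫ natHomπ (J.comp V F) (J.comp V G) a = natHomπ F G (J.obj a) :=
  natHomLift_π _ _ _

/-- The `V`-functor `[J, C] : [B, C] → [A, C]` given by precomposition with `J`. -/
def precomp (J : EnrichedFunctor V A B) (C : Type w₂) [EnrichedCategory V C] :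
    EnrichedFunctor V (EnrichedFunctor V B C) (EnrichedFunctor V A C) where
  obj F := J.comp V F
  map F G := restrict J F G
  map_id F := natHom_ext fun a => by
    rw [Category.assoc, restrict_π]
    exact (functorCategory_id_π F (J.obj a)).trans (functorCategory_id_π (J.comp V F) a).symm
  map_comp F G H := natHom_ext fun a => by
    rw [Category.assoc, restrict_π, Category.assoc]
    refine (functorCategory_comp_π F G H (J.obj a)).trans
      (Eq.trans ?_ (congrArg (fun z => (restrict J F G ⊗ₘ restrict J G H) ≫ z)
        (functorCategory_comp_π (J.comp V F) (J.comp V G) (J.comp V H) a)).symm)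
    refine Eq.trans ?_ (tensorHom_comp_tensorHom_assoc _ _ _ _ _).symm
    rw [restrict_π, restrict_π]
    rfl

end Hom

theorem uncurry_naturality_iff {X X' Y Y' H : V} (s : H ⟶ (ihom X).obj X')
    (t : H ⟶ (ihom Y).obj Y') (m : 𝟙_ V ⟶ (ihom X).obj Y) (m' : 𝟙_ V ⟶ (ihom X').obj Y') :
    ((ρ_ H).inv ≫ (s ⊗ₘ m') ≫ eComp V X X' Y' = (λ_ H).inv ≫ (m ⊗ₘ t) ≫ eComp V X Y Y') ↔
    MonoidalClosed.uncurry s ≫ MonoidalClosed.uncurry' m' =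
      MonoidalClosed.uncurry' m ▷ _ ≫ MonoidalClosed.uncurry t := by
  rw [← MonoidalClosed.uncurry_injective.eq_iff, MonoidalClosed.uncurry_natural_left (ρ_ H).inv,
    MonoidalClosed.uncurry_natural_left (λ_ H).inv, uncurry_comp_aux, uncurry_comp_aux,
    MonoidalClosed.uncurry', MonoidalClosed.uncurry', comp_whiskerRight, Category.assoc]
  have e1 : X ◁ (ρ_ H).inv ≫ (α_ X H (𝟙_ V)).inv = (ρ_ (X ⊗ H)).inv := by simp
  have e2 : X ◁ (λ_ H).inv ≫ (α_ X (𝟙_ V) H).inv = (ρ_ X).inv ▷ H := by simp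
  rw [reassoc_of% e1, reassoc_of% e2, ← rightUnitor_inv_naturality_assoc]

theorem uncurry_wedge_iff {X X' Y Y' H P : V} (s : H ⟶ (ihom X).obj X')
    (t : H ⟶ (ihom Y).obj Y') (k : X ⊗ P ⟶ Y) (k' : X' ⊗ P ⟶ Y') :
    ((β_ P H).hom ≫ (s ⊗ₘ MonoidalClosed.curry k') ≫ eComp V X X' Y' =
      (MonoidalClosed.curry k ⊗ₘ t) ≫ eComp V X Y Y') ↔
    X ◁ (β_ P H).hom ≫ (α_ X H P).inv ≫ MonoidalClosed.uncurry s ▷ P ≫ k' =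
      (α_ X P H).inv ≫ k ▷ H ≫ MonoidalClosed.uncurry t := by
  rw [← MonoidalClosed.uncurry_injective.eq_iff, MonoidalClosed.uncurry_natural_left (β_ P H).hom,
    uncurry_comp_aux, uncurry_comp_aux, MonoidalClosed.uncurry_curry,
    MonoidalClosed.uncurry_curry]

theorem uncurry_corep {C : Type w₁} [EnrichedCategory V C] (c x y : C) {H : V}
    (g : H ⟶ (x ⟶[V] y)) :
    MonoidalClosed.uncurry (g ≫ (corep c).map x y) = (_ ◁ g) ≫ eComp V c x y := by
  rw [MonoidalClosed.uncurry_natural_left]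
  exact congrArg (_ ≫ ·) (MonoidalClosed.uncurry_curry _)

section RanCone

variable {A : Type w₁} [EnrichedCategory V A] {B : Type w₂} [EnrichedCategory V B]
  {C : Type w₃} [EnrichedCategory V C]

theorem ranCone_aux {r x x' y y' : C} {P H : V}
    (p : P ⟶ (r ⟶[V] x)) (j : H ⟶ (x ⟶[V] x')) (e : 𝟙_ V ⟶ (x ⟶[V] y))
    (e' : 𝟙_ V ⟶ (x' ⟶[V] y')) (g : H ⟶ (y ⟶[V] y'))
    (h : (ρ_ H).inv ≫ (j ⊗ₘ e') ≫ eComp V x x' y' = (λ_ H).inv ≫ (e ⊗ₘ g) ≫ eComp V x y y') :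
    (p ⊗ₘ j) ≫ eComp V r x x' ≫ (ρ_ _).inv ≫ (_ ◁ e') ≫ eComp V r x' y' =
      (p ≫ (ρ_ _).inv ≫ (_ ◁ e) ≫ eComp V r x y) ▷ H ≫ (_ ◁ g) ≫ eComp V r y y' := by
  have e1 : (p ⊗ₘ j) ≫ eComp V r x x' ≫ (ρ_ _).inv ≫ (_ ◁ e') ≫ eComp V r x' y' =
      (p ⊗ₘ ((ρ_ H).inv ≫ (j ⊗ₘ e') ≫ eComp V x x' y')) ≫ eComp V r x y' := by
    rw [← whiskerLeft_comp_tensorHom_assoc, eComp_tensor_assoc,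
      ← Category.assoc (p ⊗ₘ j), rightUnitor_inv_naturality_assoc]
    simp [MonoidalCategory.tensorHom_def]
  have e2 : (p ≫ (ρ_ _).inv ≫ (_ ◁ e) ≫ eComp V r x y) ▷ H ≫ (_ ◁ g) ≫ eComp V r y y' =
      (p ⊗ₘ ((λ_ H).inv ≫ (e ⊗ₘ g) ≫ eComp V x y y')) ≫ eComp V r x y' := by
    rw [← whiskerLeft_comp_tensorHom_assoc, eComp_tensor_assoc, rightUnitor_inv_naturality_assoc,
      ← MonoidalCategory.tensorHom_def_assoc p e]
    simp [MonoidalCategory.tensorHom_def]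
  rw [e1, e2, h]

theorem ranCone_aux_map (R : EnrichedFunctor V B C) {b x x' : B} {H Z : V} (j : H ⟶ (x ⟶[V] x'))
    (z : (R.obj b ⟶[V] R.obj x') ⟶ Z) :
    ((_ ◁ j) ≫ eComp V b x x') ≫ R.map b x' ≫ z =
      (R.map b x ⊗ₘ (j ≫ R.map x x')) ≫ eComp V (R.obj b) (R.obj x) (R.obj x') ≫ z := by
  rw [Category.assoc, EnrichedFunctor.map_comp_assoc, whiskerLeft_comp_tensorHom_assoc]

theorem limitComparison_aux {c x y y' : C} {W W' H : V}
    (w : W ⊗ H ⟶ W') (m : W ⟶ (x ⟶[V] y)) (m' : W' ⟶ (x ⟶[V] y')) (g : H ⟶ (y ⟶[V] y'))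
    (h : w ≫ m' = m ▷ H ≫ (_ ◁ g) ≫ eComp V x y y') :
    W ◁ (β_ (c ⟶[V] x) H).hom ≫ (α_ _ _ _).inv ≫ w ▷ _ ≫
        (β_ W' (c ⟶[V] x)).hom ≫ (_ ◁ m') ≫ eComp V c x y' =
      (α_ _ _ _).inv ≫ ((β_ W (c ⟶[V] x)).hom ≫ (_ ◁ m) ≫ eComp V c x y) ▷ H ≫
        (_ ◁ g) ≫ eComp V c y y' := by
  rw [BraidedCategory.braiding_naturality_left_assoc, ← MonoidalCategory.whiskerLeft_comp_assoc, h,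
    BraidedCategory.braiding_tensor_left_hom]
  simp only [Category.assoc, Iso.inv_hom_id_assoc, comp_whiskerRight,
    MonoidalCategory.whiskerLeft_comp]
  rw [← MonoidalCategory.whiskerLeft_comp_assoc W, SymmetricCategory.symmetry]
  simp only [MonoidalCategory.whiskerLeft_id, Category.id_comp, whisker_assoc,
    Category.assoc]
  rw [← e_assoc, associator_inv_naturality_right_assoc, whisker_exchange_assoc]

/-- The composite `B(b, J -) ⟶ C(R b, R J -) ⟶ C(R b, G -)` of the action of `R` and of `ε`. -/
def ranCone {J : EnrichedFunctor V A B} {G : EnrichedFunctor V A C} {R : EnrichedFunctor V B C}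
    (ε : VNatTrans (J.comp V R) G) (b : B) :
    VNatTrans (J.comp V (corep b)) (G.comp V (corep (R.obj b))) where
  app a := MonoidalClosed.curry' (R.map b (J.obj a) ≫ (ρ_ _).inv ≫ (_ ◁ ε.app a) ≫
    eComp V (R.obj b) (R.obj (J.obj a)) (G.obj a))
  naturality a a' := by
    refine (uncurry_naturality_iff _ _ _ _).2 ?_
    rw [MonoidalClosed.uncurry'_curry', MonoidalClosed.uncurry'_curry']
    refine (congrArg (· ≫ _) (uncurry_corep b _ _ _)).trans
      (Eq.trans ?_ (congrArg (_ ≫ ·) (uncurry_corep (R.obj b) _ _ _)).symm)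
    have h := ranCone_aux (R.map b (J.obj a)) _ _ _ _ (ε.naturality a a')
    exact (ranCone_aux_map R _ _).trans h

end RanCone

section Kan

variable [HasLimits V] {A : Type u} [EnrichedCategory V A]

/-- For `μ : W ⟶ C(X, G -)`, the induced morphism `C(c, X) ⟶ [A, V](W, C(c, G -))`. -/
def limitComparison {C : Type w₂} [EnrichedCategory V C] (W : EnrichedFunctor V A V)
    (G : EnrichedFunctor V A C) (X : C) (μ : VNatTrans W (G.comp V (corep X))) (c : C) :
    (c ⟶[V] X) ⟶ (W ⟶[V] (G.comp V (corep c))) :=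
  natHomLift (F := W) (G := G.comp V (corep c))
    (fun a => MonoidalClosed.curry ((β_ (W.obj a) (c ⟶[V] X)).hom ≫
      ((c ⟶[V] X) ◁ MonoidalClosed.uncurry' (μ.app a)) ≫ eComp V c X (G.obj a))) (by
    intro a a'
    refine (uncurry_wedge_iff _ _ _ _).2 ?_
    refine Eq.trans ?_ (congrArg (fun z => _ ≫ _ ≫ z) (uncurry_corep c _ _ _)).symm
    have h := (uncurry_naturality_iff _ _ _ _).1 (μ.naturality a a')
    replace h := h.trans (congrArg (_ ≫ ·) (uncurry_corep X _ _ _))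
    exact limitComparison_aux _ _ _ _ h)

/-- `μ : W ⟶ C(X, G -)` exhibits `X` as the limit of `G` weighted by `W`:
`C(c, X) ⟶ [A, V](W, C(c, G -))` is invertible for every `c`. -/
def IsWeightedLimit {C : Type w₂} [EnrichedCategory V C] (W : EnrichedFunctor V A V)
    (G : EnrichedFunctor V A C) (X : C) (μ : VNatTrans W (G.comp V (corep X))) : Prop :=
  ∀ c : C, IsIso (limitComparison W G X μ c)

variable {B : Type w₂} [EnrichedCategory V B] {C : Type w₃} [EnrichedCategory V C]

/-- `ε : R J ⟶ G` exhibits `R` as the (pointwise) right Kan extension of `G` along `J`: for each `b`,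
`R b` is the limit of `G` weighted by `B(b, J -)`. -/
def IsRightKan (J : EnrichedFunctor V A B) (G : EnrichedFunctor V A C) (R : EnrichedFunctor V B C)
    (ε : VNatTrans (J.comp V R) G) : Prop :=
  ∀ b : B, IsWeightedLimit (J.comp V (corep b)) G (R.obj b) (ranCone ε b)

/-- `η : G ⟶ L J` exhibits `L` as the (pointwise) left Kan extension of `G` along `J`: dually, for
each `b`, `L b` is the colimit of `G` weighted by `B(J -, b)`, i.e. the morphism
`C(L b, c) ⟶ [Aᵒᵖ, V](B(J -, b), C(G -, c))` is invertible for every `c`. -/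
def IsLeftKan (J : EnrichedFunctor V A B) (G : EnrichedFunctor V A C) (L : EnrichedFunctor V B C)
    (η : VNatTrans G (J.comp V L)) : Prop :=
  IsRightKan (opFunctor J) (opFunctor G) (opFunctor L) (opNatTrans η)

end Kan

/-- `P` is `V`-fully faithful if its actions on hom-objects are isomorphisms. -/
def IsVFullyFaithful {A : Type w₁} [EnrichedCategory V A] {C : Type w₂} [EnrichedCategory V C]
    (P : EnrichedFunctor V A C) : Prop :=
  ∀ a a' : A, IsIso (P.map a a')

section Main

variable [HasLimits V] {A B : Type u} [EnrichedCategory V A] [EnrichedCategory V B]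

/-- `J` is a `V`-lax epimorphism if `[J, C]` is `V`-fully faithful for all small `V`-categories `C`. -/
def IsVLaxEpi (J : EnrichedFunctor V A B) : Prop :=
  ∀ (C : Type u) [EnrichedCategory V C], IsVFullyFaithful (precomp J C)

/-- `J` is `V`-dense if `Lan_J J` exists and is `V`-naturally isomorphic to the identity. -/
def IsVDense (J : EnrichedFunctor V A B) : Prop :=
  ∃ (L : EnrichedFunctor V B B) (η : VNatTrans J (J.comp V L)),
    IsLeftKan J J L η ∧ ∃ α : VNatTrans L (EnrichedFunctor.id V B), IsNatIso α

/-- `J` is `V`-codense if `Ran_J J` exists and is `V`-naturally isomorphic to the identity. -/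
def IsVCodense (J : EnrichedFunctor V A B) : Prop :=
  ∃ (R : EnrichedFunctor V B B) (ε : VNatTrans (J.comp V R) J),
    IsRightKan J J R ε ∧ ∃ α : VNatTrans R (EnrichedFunctor.id V B), IsNatIso α

/-- `J` is absolutely `V`-dense if it is `V`-dense and `Lan_J J` is preserved by all `V`-functors
`F : B → V`, i.e. `F Lan_J J`, with the whiskered unit, is the left Kan extension of `F J`. -/
def IsAbsolutelyVDense (J : EnrichedFunctor V A B) : Prop :=
  IsVDense J ∧
    ∀ (L : EnrichedFunctor V B B) (η : VNatTrans J (J.comp V L)), IsLeftKan J J L η →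
      ∀ F : EnrichedFunctor V B V, IsLeftKan J (J.comp V F) (L.comp V F) (η.whiskerUnit F)

/-- `J` is absolutely `V`-codense if it is `V`-codense and `Ran_J J` is preserved by all `V`-functors
`F : B → V`, i.e. `F Ran_J J`, with the whiskered counit, is the right Kan extension of `F J`. -/
def IsAbsolutelyVCodense (J : EnrichedFunctor V A B) : Prop :=
  IsVCodense J ∧
    ∀ (R : EnrichedFunctor V B B) (ε : VNatTrans (J.comp V R) J), IsRightKan J J R ε →
      ∀ F : EnrichedFunctor V B V, IsRightKan J (J.comp V F) (R.comp V F) (ε.whiskerCounit F)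

end Main

end VCat

end

/-!
The three conditions are all equivalent to the statement that restriction along `J` is fully
faithful on `V`-valued `V`-functors. Hom-objects of functor categories are ends, so this is
expressed as a bijection on wedges (`ExtendsWedges`, `isIso_restrict_iff`), and the universal
property of a pointwise right Kan extension is likewise expressed as unique factorization of
natural families `X ⊗ B(b, J a) ⟶ C(c, G a)` through the legs `B(b, J a) ⟶ C(R b, G a)`
(`IsUniversalCounit`, `isRightKan_iff`).

* If restriction along `J` is fully faithful on `V`-valued functors, then every `G : B ⟶ C` is the
  pointwise right Kan extension of `G J` along `J`, with identity counit: by the Yoneda lemma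
  `C(c, G b)` is the end `[B, V](B(b, -), C(c, G -))`, hence also `[A, V](B(b, J -), C(c, G J -))`
  (`isUniversalCounit_idNatTrans`). For `G = Id` this is codensity. Since weighted limits are
  unique, the statement for `G = F` shows that every right Kan extension of `J` along `J` is
  preserved by `F` (`IsUniversalCounit.whiskerCounit_of`). Since pointwise Kan extensions are Kan
  extensions (`IsUniversalCounit.existsUnique_isWedge`), restriction along `J` is fully faithful
  for every `C`.
* Conversely, let `R ≅ Id` be a right Kan extension of `J` along `J` that `F` preserves.
  Transported along the isomorphism, its counit becomes an endomorphism `θ` of `F J`, and wedges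
  `H ⟶ F` correspond to wedges `H J ⟶ F J` by restriction followed by `θ`. So it suffices that `θ`
  is invertible. The universal property gives `τ : F ⟶ F` with `θ (τ J) = 1`, and naturality of
  `τ` with respect to the morphisms of `B` underlying `θ` gives `(τ J) θ = 1`
  (`IsUniversalCounit.extendsWedges_of_isNatIso`).
* A lax epimorphism has unique extension of wedges even for large codomains, as only a small full
  subcategory of the codomain is involved (`IsVLaxEpi.extendsWedges`). With codomain `Vᵒᵖ` this
  gives the same property of `Jᵒᵖ`. Density is codensity of `Jᵒᵖ`, and preservation by `F : B ⟶ V`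
  is preservation by `Fᵒᵖ : Bᵒᵖ ⟶ Vᵒᵖ`; as the arguments above allow arbitrary codomains, they
  cover density as well.
-/

noncomputable section

namespace VCat

/-! ### Composition of generalized elements of hom-objects -/

section Calculus

variable {V : Type v} [Category.{u} V] [MonoidalCategory V]
  {C : Type w₁} [EnrichedCategory V C] {D : Type w₂} [EnrichedCategory V D]

/-- The composite of generalized elements of two hom-objects of a `V`-category. -/
def gcomp {x y z : C} {P Q : V} (f : P ⟶ (x ⟶[V] y)) (g : Q ⟶ (y ⟶[V] z)) :
    P ⊗ Q ⟶ (x ⟶[V] z) :=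
  (f ⊗ₘ g) ≫ eComp V x y z

theorem whiskerRight_gcomp {x y z : C} {P P' Q : V} (p : P' ⟶ P) (f : P ⟶ (x ⟶[V] y))
    (g : Q ⟶ (y ⟶[V] z)) : p ▷ Q ≫ gcomp f g = gcomp (p ≫ f) g :=
  whiskerRight_comp_tensorHom_assoc _ _ _ _

theorem whiskerLeft_gcomp {x y z : C} {P Q Q' : V} (q : Q' ⟶ Q) (f : P ⟶ (x ⟶[V] y))
    (g : Q ⟶ (y ⟶[V] z)) : P ◁ q ≫ gcomp f g = gcomp f (q ≫ g) :=
  whiskerLeft_comp_tensorHom_assoc _ _ _ _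

theorem gcomp_assoc {P Q R : V} {w x y z : C} (f : P ⟶ (w ⟶[V] x)) (g : Q ⟶ (x ⟶[V] y))
    (h : R ⟶ (y ⟶[V] z)) :
    gcomp (gcomp f g) h = (α_ P Q R).hom ≫ gcomp f (gcomp g h) := by
  rw [← Iso.inv_comp_eq]
  simp only [gcomp, MonoidalCategory.tensorHom_def, comp_whiskerRight,
    MonoidalCategory.whiskerLeft_comp, Category.assoc, ← e_assoc,
    associator_inv_naturality_left_assoc, associator_inv_naturality_middle_assoc,
    associator_inv_naturality_right_assoc]
  rw [whisker_exchange_assoc]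

theorem eId_gcomp {x y : C} {P : V} (f : P ⟶ (x ⟶[V] y)) :
    gcomp (eId V x) f = (λ_ P).hom ≫ f := by
  rw [← cancel_epi (λ_ P).inv]
  simp [gcomp, MonoidalCategory.tensorHom_def']

theorem gcomp_eId {x y : C} {P : V} (f : P ⟶ (x ⟶[V] y)) :
    gcomp f (eId V y) = (ρ_ P).hom ≫ f := by
  rw [← cancel_epi (ρ_ P).inv]
  simp [gcomp, MonoidalCategory.tensorHom_def]

theorem gcomp_map (F : EnrichedFunctor V C D) {x y z : C} {P Q : V} (f : P ⟶ (x ⟶[V] y))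
    (g : Q ⟶ (y ⟶[V] z)) :
    gcomp f g ≫ F.map x z = gcomp (f ≫ F.map x y) (g ≫ F.map y z) := by
  simp [gcomp]

/-- The composite of a generalized element of a hom-object with a morphism of the underlying
category. -/
def post {x y z : C} {P : V} (f : P ⟶ (x ⟶[V] y)) (e : 𝟙_ V ⟶ (y ⟶[V] z)) : P ⟶ (x ⟶[V] z) :=
  (ρ_ P).inv ≫ gcomp f e

theorem comp_post {x y z : C} {P Q : V} (p : Q ⟶ P) (f : P ⟶ (x ⟶[V] y))
    (e : 𝟙_ V ⟶ (y ⟶[V] z)) : p ≫ post f e = post (p ≫ f) e := by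
  rw [post, post, ← whiskerRight_gcomp, rightUnitor_inv_naturality_assoc]

theorem post_eq {x y z : C} {P : V} (f : P ⟶ (x ⟶[V] y)) (e : 𝟙_ V ⟶ (y ⟶[V] z)) :
    post f e = f ≫ (ρ_ _).inv ≫ _ ◁ e ≫ eComp V x y z := by
  simp [post, gcomp, MonoidalCategory.tensorHom_def]

theorem post_eId {x y : C} {P : V} (f : P ⟶ (x ⟶[V] y)) : post f (eId V y) = f := by
  rw [post, gcomp_eId, Iso.inv_hom_id_assoc]

theorem post_map (F : EnrichedFunctor V C D) {x y z : C} {P : V} (f : P ⟶ (x ⟶[V] y))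
    (e : 𝟙_ V ⟶ (y ⟶[V] z)) :
    post f e ≫ F.map x z = post (f ≫ F.map x y) (e ≫ F.map y z) := by
  rw [post, Category.assoc, gcomp_map, post]

theorem post_gcomp {w x y z : C} {P Q : V} (f : P ⟶ (w ⟶[V] x)) (g : Q ⟶ (x ⟶[V] y))
    (e : 𝟙_ V ⟶ (y ⟶[V] z)) : post (gcomp f g) e = gcomp f (post g e) := by
  rw [post, post, gcomp_assoc, ← whiskerLeft_gcomp]
  simp

theorem gcomp_post_left {w x y z : C} {P Q : V} (f : P ⟶ (w ⟶[V] x)) (e : 𝟙_ V ⟶ (x ⟶[V] y))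
    (g : Q ⟶ (y ⟶[V] z)) : gcomp (post f e) g = gcomp f ((λ_ Q).inv ≫ gcomp e g) := by
  rw [post, ← whiskerRight_gcomp, gcomp_assoc, ← whiskerLeft_gcomp]
  simp

theorem post_post {w x y z : C} {P : V} (f : P ⟶ (w ⟶[V] x)) (d : 𝟙_ V ⟶ (x ⟶[V] y))
    (e : 𝟙_ V ⟶ (y ⟶[V] z)) : post (post f d) e = post f (post d e) := by
  rw [post, gcomp_post_left, post, post, unitors_inv_equal]

theorem eId_post {x y : C} (e : 𝟙_ V ⟶ (x ⟶[V] y)) : post (eId V x) e = e := by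
  rw [post, eId_gcomp, unitors_equal, Iso.inv_hom_id_assoc]

end Calculus

/-! ### Wedges and pointwise right Kan extensions -/

variable {V : Type v} [Category.{u} V] [MonoidalCategory V] [SymmetricCategory V]

section Wedges

variable {A : Type w₁} [EnrichedCategory V A] {B : Type w₂} [EnrichedCategory V B]
  {C : Type w₃} [EnrichedCategory V C]

theorem isWedge_iff (F G : EnrichedFunctor V A C) {X : V}
    (k : ∀ a, X ⟶ (F.obj a ⟶[V] G.obj a)) :
    IsWedge F G k ↔ ∀ a a' : A, (β_ X (a ⟶[V] a')).hom ≫ gcomp (F.map a a') (k a') =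
      gcomp (k a) (G.map a a') :=
  Iff.rfl

theorem VNatTrans.post_naturality {F G : EnrichedFunctor V A C} (α : VNatTrans F G) (a a' : A) :
    post (F.map a a') (α.app a') = (λ_ _).inv ≫ gcomp (α.app a) (G.map a a') :=
  α.naturality a a'

theorem VNatTrans.isWedge {F G : EnrichedFunctor V A C} (α : VNatTrans F G) :
    IsWedge F G α.app := by
  rw [isWedge_iff]
  intro a a'
  rw [← cancel_epi (λ_ _).inv, ← α.post_naturality, leftUnitor_inv_braiding_assoc]
  rfl

theorem IsWedge.post {F G H : EnrichedFunctor V A C} {X : V}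
    {k : ∀ a, X ⟶ (F.obj a ⟶[V] G.obj a)} (hk : IsWedge F G k)
    {e : ∀ a, 𝟙_ V ⟶ (G.obj a ⟶[V] H.obj a)} (he : IsWedge G H e) :
    IsWedge F H (fun a => VCat.post (k a) (e a)) :=
  (hk.comp he).precomp (ρ_ X).inv

theorem IsWedge.map {F G : EnrichedFunctor V A B} {X : V}
    {k : ∀ a, X ⟶ (F.obj a ⟶[V] G.obj a)} (hk : IsWedge F G k) (H : EnrichedFunctor V B C) :
    IsWedge (F.comp V H) (G.comp V H) (fun a => k a ≫ H.map _ _) := by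
  intro a a'
  have h := (isWedge_iff _ _ _).1 hk a a' =≫ H.map _ _
  rw [Category.assoc, gcomp_map, gcomp_map] at h
  exact h

theorem IsWedge.post_naturality {F G : EnrichedFunctor V A C}
    {k : ∀ a, 𝟙_ V ⟶ (F.obj a ⟶[V] G.obj a)} (hk : IsWedge F G k) (a a' : A) :
    VCat.post (F.map a a') (k a') = (λ_ _).inv ≫ gcomp (k a) (G.map a a') := by
  rw [← (isWedge_iff _ _ _).1 hk, leftUnitor_inv_braiding_assoc]
  rfl

/-- A wedge indexed by the unit is natural with respect to the morphisms of the underlying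
category. -/
theorem IsWedge.post_map_comm {F G : EnrichedFunctor V A C}
    {k : ∀ a, 𝟙_ V ⟶ (F.obj a ⟶[V] G.obj a)} (hk : IsWedge F G k) {a a' : A}
    (e : 𝟙_ V ⟶ (a ⟶[V] a')) :
    VCat.post (e ≫ F.map a a') (k a') = VCat.post (k a) (e ≫ G.map a a') := by
  rw [← comp_post, hk.post_naturality, leftUnitor_inv_naturality_assoc, whiskerLeft_gcomp,
    unitors_inv_equal]
  rfl

/-- `isWedge_iff` for a restricted `V`-functor `F J`, typed so that both sides can be rewritten. -/
theorem isWedge_comp_left_iff (J : EnrichedFunctor V A B) (F : EnrichedFunctor V B C)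
    (G : EnrichedFunctor V A C) {X : V} (k : ∀ a, X ⟶ (F.obj (J.obj a) ⟶[V] G.obj a)) :
    IsWedge (J.comp V F) G k ↔ ∀ a a' : A, (β_ X (a ⟶[V] a')).hom ≫
      gcomp (J.map a a' ≫ F.map _ _) (k a') = gcomp (k a) (G.map a a') :=
  Iff.rfl

/-- Composition of `V`-functors is not definitionally associative on hom-objects, but the objects
agree definitionally, so the families of morphisms need no transport. -/
theorem isWedge_comp_assoc_iff {D : Type w₄} [EnrichedCategory V D]
    (W : EnrichedFunctor V A D)
    (J : EnrichedFunctor V A B) (G : EnrichedFunctor V B C) (H : EnrichedFunctor V C D) {X : V}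
    (k : ∀ a, X ⟶ (W.obj a ⟶[V] H.obj (G.obj (J.obj a)))) :
    IsWedge W ((J.comp V G).comp V H) k ↔ IsWedge W (J.comp V (G.comp V H)) k :=
  forall_congr' fun a => forall_congr' fun _ => Eq.congr rfl
    (congrArg (fun z => (k a ⊗ₘ z) ≫ eComp V _ _ _) (Category.assoc _ _ _))

theorem isWedge_id_comp_iff (F G : EnrichedFunctor V B C) {X : V}
    (k : ∀ b, X ⟶ (F.obj b ⟶[V] G.obj b)) :
    IsWedge ((EnrichedFunctor.id V B).comp V F) G k ↔ IsWedge F G k :=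
  forall_congr' fun _ => forall_congr' fun b' => Eq.congr
    (congrArg (fun z => (β_ _ _).hom ≫ (z ⊗ₘ k b') ≫ eComp V _ _ _) (Category.id_comp _)) rfl

theorem isWedge_comp_id_iff (F G : EnrichedFunctor V B C) {X : V}
    (k : ∀ b, X ⟶ (F.obj b ⟶[V] G.obj b)) :
    IsWedge F ((EnrichedFunctor.id V B).comp V G) k ↔ IsWedge F G k :=
  forall_congr' fun b => forall_congr' fun _ => Eq.congr rfl
    (congrArg (fun z => (k b ⊗ₘ z) ≫ eComp V _ _ _) (Category.id_comp _))

/-- Moving a generalized element `l` past one more morphism of a wedge. -/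
theorem braiding_gcomp_gcomp {x y y' z z' : C} {X P Q : V} {h : P ⟶ (x ⟶[V] y)}
    {l : X ⟶ (y ⟶[V] z)} {g : Q ⟶ (z ⟶[V] z')} {h' : Q ⟶ (y ⟶[V] y')} {l' : X ⟶ (y' ⟶[V] z')}
    (e : (β_ X Q).hom ≫ gcomp h' l' = gcomp l g) :
    gcomp ((β_ X P).hom ≫ gcomp h l) g =
      (α_ X P Q).hom ≫ (β_ X (P ⊗ Q)).hom ≫ gcomp (gcomp h h') l' := by
  rw [← whiskerRight_gcomp, gcomp_assoc, ← e, ← whiskerLeft_gcomp, gcomp_assoc,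
    BraidedCategory.braiding_tensor_right_hom]
  simp

theorem whiskerLeft_braiding_gcomp {x y z : C} {X P Q : V} (p : Q ⟶ P) (h : P ⟶ (x ⟶[V] y))
    (l : X ⟶ (y ⟶[V] z)) :
    X ◁ p ≫ (β_ X P).hom ≫ gcomp h l = (β_ X Q).hom ≫ gcomp (p ≫ h) l := by
  rw [BraidedCategory.braiding_naturality_right_assoc, whiskerRight_gcomp]

/-- The families `X ⊗ B(b, J a) ⟶ C(c, G a)` that are `V`-natural in `a`; these are the transposes
of the wedges `X ⟶ [B(b, J a), C(c, G a)]`. -/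
def IsNaturalFamily (J : EnrichedFunctor V A B) (G : EnrichedFunctor V A C) (b : B) (c : C) {X : V}
    (t : ∀ a, X ⊗ (b ⟶[V] J.obj a) ⟶ (c ⟶[V] G.obj a)) : Prop :=
  ∀ a a', gcomp (t a) (G.map a a') =
    (α_ _ _ _).hom ≫ X ◁ gcomp (𝟙 (b ⟶[V] J.obj a)) (J.map a a') ≫ t a'

/-- The component at `a` of a `V`-natural transformation `R J ⟶ G`, typed so that composites with
generalized elements of `C(x, R (J a))` are syntactically well-formed. -/
def counitApp {J : EnrichedFunctor V A B} {G : EnrichedFunctor V A C} {R : EnrichedFunctor V B C}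
    (ε : VNatTrans (J.comp V R) G) (a : A) : 𝟙_ V ⟶ (R.obj (J.obj a) ⟶[V] G.obj a) :=
  ε.app a

theorem counitApp_naturality {J : EnrichedFunctor V A B} {G : EnrichedFunctor V A C}
    {R : EnrichedFunctor V B C} (ε : VNatTrans (J.comp V R) G) (a a' : A) :
    post (J.map a a' ≫ R.map _ _) (counitApp ε a') =
      (λ_ _).inv ≫ gcomp (counitApp ε a) (G.map a a') :=
  ε.naturality a a'

/-- The composite `B(b, J a) ⟶ C(R b, R (J a)) ⟶ C(R b, G a)`: the legs of the cone that a right Kan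
extension is to make universal. -/
def ranLeg {J : EnrichedFunctor V A B} {G : EnrichedFunctor V A C} {R : EnrichedFunctor V B C}
    (ε : VNatTrans (J.comp V R) G) (b : B) (a : A) : (b ⟶[V] J.obj a) ⟶ (R.obj b ⟶[V] G.obj a) :=
  post (R.map b (J.obj a)) (counitApp ε a)

/-- The legs are natural in `a`. -/
theorem ranLeg_gcomp_map {J : EnrichedFunctor V A B} {G : EnrichedFunctor V A C}
    {R : EnrichedFunctor V B C} (ε : VNatTrans (J.comp V R) G) (b : B) (a a' : A) :
    gcomp (ranLeg ε b a) (G.map a a') =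
      gcomp (𝟙 (b ⟶[V] J.obj a)) (J.map a a') ≫ ranLeg ε b a' := by
  rw [ranLeg, ranLeg, gcomp_post_left, ← counitApp_naturality, comp_post, gcomp_map, ← post_gcomp,
    Category.id_comp]

/-- The legs are natural in `b`. -/
theorem map_gcomp_ranLeg {J : EnrichedFunctor V A B} {G : EnrichedFunctor V A C}
    {R : EnrichedFunctor V B C} (ε : VNatTrans (J.comp V R) G) (b b' : B) (a : A) :
    gcomp (R.map b b') (ranLeg ε b' a) = eComp V b b' (J.obj a) ≫ ranLeg ε b a := by
  rw [ranLeg, ranLeg, ← post_gcomp, comp_post, R.map_comp]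
  rfl

theorem eId_ranLeg {J : EnrichedFunctor V A B} {G : EnrichedFunctor V A C}
    {R : EnrichedFunctor V B C} (ε : VNatTrans (J.comp V R) G) (a : A) :
    eId V (J.obj a) ≫ ranLeg ε (J.obj a) a = counitApp ε a := by
  rw [ranLeg, comp_post, R.map_id, eId_post]

/-- The universal property of a pointwise right Kan extension, in terms of generalized elements:
natural families factor uniquely through the legs. -/
def IsUniversalCounit {J : EnrichedFunctor V A B} {G : EnrichedFunctor V A C}
    {R : EnrichedFunctor V B C} (ε : VNatTrans (J.comp V R) G) : Prop :=
  ∀ (b : B) (c : C) ⦃X : V⦄ (t : ∀ a, X ⊗ (b ⟶[V] J.obj a) ⟶ (c ⟶[V] G.obj a)),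
    IsNaturalFamily J G b c t → ∃! s : X ⟶ (c ⟶[V] R.obj b), ∀ a, gcomp s (ranLeg ε b a) = t a

theorem isNaturalFamily_gcomp_ranLeg {J : EnrichedFunctor V A B} {G : EnrichedFunctor V A C}
    {R : EnrichedFunctor V B C} (ε : VNatTrans (J.comp V R) G) {b : B} {c : C} {X : V}
    (s : X ⟶ (c ⟶[V] R.obj b)) : IsNaturalFamily J G b c (fun a => gcomp s (ranLeg ε b a)) := by
  intro a a'
  rw [gcomp_assoc, ranLeg_gcomp_map, whiskerLeft_gcomp]

theorem IsUniversalCounit.hom_ext {J : EnrichedFunctor V A B} {G : EnrichedFunctor V A C}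
    {R : EnrichedFunctor V B C} {ε : VNatTrans (J.comp V R) G} (hε : IsUniversalCounit ε)
    {b : B} {c : C} {X : V} {s s' : X ⟶ (c ⟶[V] R.obj b)}
    (h : ∀ a, gcomp s (ranLeg ε b a) = gcomp s' (ranLeg ε b a)) : s = s' :=
  (hε b c _ (isNaturalFamily_gcomp_ranLeg ε s')).unique h fun _ => rfl

/-- A pointwise right Kan extension is a right Kan extension: wedges from `H` to `R` correspond to
wedges from `H J` to `G`. -/
theorem IsUniversalCounit.existsUnique_isWedge {J : EnrichedFunctor V A B}
    {G : EnrichedFunctor V A C} {R : EnrichedFunctor V B C} {ε : VNatTrans (J.comp V R) G}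
    (hε : IsUniversalCounit ε) {H : EnrichedFunctor V B C} {X : V}
    {l : ∀ a, X ⟶ (H.obj (J.obj a) ⟶[V] G.obj a)} (hl : IsWedge (J.comp V H) G l) :
    ∃! k : ∀ b, X ⟶ (H.obj b ⟶[V] R.obj b),
      IsWedge H R k ∧ ∀ a, VCat.post (k (J.obj a)) (counitApp ε a) = l a := by
  -- For a wedge `k`, the generalized element `k b` is determined by its composites with the legs.
  have key (k : ∀ b, X ⟶ (H.obj b ⟶[V] R.obj b)) (hk : IsWedge H R k)
      (hkl : ∀ a, VCat.post (k (J.obj a)) (counitApp ε a) = l a) (b : B) (a : A) :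
      gcomp (k b) (ranLeg ε b a) = (β_ _ _).hom ≫ gcomp (H.map b (J.obj a)) (l a) := by
    rw [ranLeg, ← post_gcomp, ← (isWedge_iff _ _ _).1 hk, ← comp_post, post_gcomp, hkl]
  have fam (b : B) : IsNaturalFamily J G b (H.obj b)
      (fun a => (β_ _ _).hom ≫ gcomp (H.map b (J.obj a)) (l a)) := by
    intro a a'
    dsimp only
    rw [braiding_gcomp_gcomp ((isWedge_comp_left_iff _ _ _ _).1 hl a a'),
      whiskerLeft_braiding_gcomp, gcomp_map, Category.id_comp]
  choose k hk using fun b => (hε b (H.obj b) _ (fam b)).exists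
  refine ⟨k, ⟨(isWedge_iff _ _ _).2 fun b b' => hε.hom_ext fun a => ?_, fun a => ?_⟩,
    fun k' hk' => funext fun b => hε.hom_ext fun a => ?_⟩
  · rw [braiding_gcomp_gcomp (hk b' a).symm, gcomp_assoc (k b), map_gcomp_ranLeg,
      ← whiskerLeft_gcomp, hk, whiskerLeft_braiding_gcomp, H.map_comp]
    rfl
  · have h := (ρ_ X).inv ≫= X ◁ eId V (J.obj a) ≫= hk (J.obj a) a
    rw [whiskerLeft_gcomp, eId_ranLeg, whiskerLeft_braiding_gcomp, H.map_id, eId_gcomp] at h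
    refine Eq.trans h ?_
    simp
  · rw [key k' hk'.1 hk'.2, hk]

/-- Every wedge between the restrictions of `F` and `G` along `J` extends uniquely to a wedge
between `F` and `G`: restriction along `J` is invertible on hom-objects. -/
def ExtendsWedges (J : EnrichedFunctor V A B) (F G : EnrichedFunctor V B C) : Prop :=
  ∀ ⦃X : V⦄ (l : ∀ a, X ⟶ (F.obj (J.obj a) ⟶[V] G.obj (J.obj a))),
    IsWedge (J.comp V F) (J.comp V G) l →
      ∃! k : ∀ b, X ⟶ (F.obj b ⟶[V] G.obj b), IsWedge F G k ∧ ∀ a, k (J.obj a) = l a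

variable (V) in
/-- The identity `V`-natural transformation. -/
def idNatTrans (F : EnrichedFunctor V A C) : VNatTrans F F where
  app a := eId V (F.obj a)
  naturality a a' := (IsWedge.id F).post_naturality a a'

/-- If `G` is the right Kan extension of its own restriction `G J`, restriction along `J` is
bijective on wedges into `G`. -/
theorem IsUniversalCounit.extendsWedges {J : EnrichedFunctor V A B} {G : EnrichedFunctor V B C}
    (h : IsUniversalCounit (J := J) (R := G) (idNatTrans V (J.comp V G)))
    (F : EnrichedFunctor V B C) : ExtendsWedges J F G := by
  intro X l hl
  obtain ⟨k, ⟨hk, hkl⟩, hu⟩ := h.existsUnique_isWedge hl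
  refine ⟨k, ⟨hk, fun a => (post_eId _).symm.trans (hkl a)⟩,
    fun k' hk' => hu _ ⟨hk'.1, fun a => ?_⟩⟩
  exact (post_eId _).trans (hk'.2 a)

end Wedges

/-! ### Transposition into internal homs and the Yoneda lemma -/

section Transpose

variable [MonoidalClosed V] {A : Type w₁} [EnrichedCategory V A] {B : Type w₂}
  [EnrichedCategory V B] {C : Type w₃} [EnrichedCategory V C]

theorem braiding_family_iff {W W' X H Z Z' : V} (w : W ⊗ H ⟶ W') (t : X ⊗ W ⟶ Z)
    (t' : X ⊗ W' ⟶ Z') (d : Z ⊗ H ⟶ Z') :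
    W ◁ (β_ X H).hom ≫ (α_ W H X).inv ≫ w ▷ X ≫ (β_ W' X).hom ≫ t' =
        (α_ W X H).inv ≫ ((β_ W X).hom ≫ t) ▷ H ≫ d ↔
      t ▷ H ≫ d = (α_ X W H).hom ≫ X ◁ w ≫ t' := by
  rw [← cancel_epi ((β_ W X).hom ▷ H), ← cancel_epi (α_ W X H).inv,
    BraidedCategory.braiding_naturality_left_assoc, BraidedCategory.braiding_tensor_left_hom]
  simp only [Category.assoc, Iso.inv_hom_id_assoc, comp_whiskerRight]
  rw [← MonoidalCategory.whiskerLeft_comp_assoc W, SymmetricCategory.symmetry]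
  simp only [MonoidalCategory.whiskerLeft_id, Category.id_comp]
  exact eq_comm

/-- Natural families are the transposes of wedges from `B(b, J -)` to `C(c, G -)`. -/
theorem isWedge_corep_iff (J : EnrichedFunctor V A B) (G : EnrichedFunctor V A C) (b : B) (c : C)
    {X : V} (t : ∀ a, X ⊗ (b ⟶[V] J.obj a) ⟶ (c ⟶[V] G.obj a)) :
    IsWedge (J.comp V (corep b)) (G.comp V (corep c))
        (fun a => MonoidalClosed.curry ((β_ (b ⟶[V] J.obj a) X).hom ≫ t a)) ↔
      IsNaturalFamily J G b c t := by
  refine forall_congr' fun a => forall_congr' fun a' => ?_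
  refine (uncurry_wedge_iff _ _ _ _).trans ?_
  have e1 : MonoidalClosed.uncurry ((J.comp V (corep b)).map a a') =
      gcomp (𝟙 (b ⟶[V] J.obj a)) (J.map a a') :=
    (uncurry_corep b _ _ _).trans
      (congrArg (· ≫ eComp V b (J.obj a) (J.obj a')) (id_tensorHom _ _).symm)
  have e2 : MonoidalClosed.uncurry ((G.comp V (corep c)).map a a') =
      _ ◁ G.map a a' ≫ eComp V c (G.obj a) (G.obj a') :=
    uncurry_corep c _ _ _
  refine (braiding_family_iff _ _ _ _).trans (Eq.congr
    ((congrArg (t a ▷ _ ≫ ·) e2).trans (MonoidalCategory.tensorHom_def_assoc _ _ _).symm)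
    (congrArg (fun z => _ ≫ X ◁ z ≫ t a') e1))

/-- Every morphism into an internal hom is the transpose of a morphism as in `isWedge_corep_iff`. -/
theorem curry_braiding_uncurry {W Z X : V} (k : X ⟶ (ihom W).obj Z) :
    MonoidalClosed.curry ((β_ W X).hom ≫ (β_ X W).hom ≫ MonoidalClosed.uncurry k) = k := by
  rw [SymmetricCategory.symmetry_assoc, MonoidalClosed.curry_uncurry]

theorem curry_braiding_injective {W Z X : V} {t t' : X ⊗ W ⟶ Z}
    (h : MonoidalClosed.curry ((β_ W X).hom ≫ t) = MonoidalClosed.curry ((β_ W X).hom ≫ t')) :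
    t = t' :=
  (cancel_epi _).1 (MonoidalClosed.curry_injective h)

/-- The Yoneda lemma: a natural family is determined by its value at the identity. -/
theorem IsNaturalFamily.eq_gcomp_map {G : EnrichedFunctor V B C} {b : B} {c : C} {X : V}
    {t : ∀ b', X ⊗ (b ⟶[V] b') ⟶ (c ⟶[V] G.obj b')}
    (ht : IsNaturalFamily (EnrichedFunctor.id V B) G b c t) (b' : B) :
    gcomp ((ρ_ X).inv ≫ X ◁ eId V b ≫ t b) (G.map b b') = t b' := by
  have h : gcomp (t b) (G.map b b') = (α_ _ _ _).hom ≫ X ◁ eComp V b b b' ≫ t b' := by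
    refine (ht b b').trans (congrArg (fun z => _ ≫ X ◁ z ≫ t b') ?_)
    exact (congrArg (· ≫ eComp V b b b') (id_tensorHom_id _ _)).trans (Category.id_comp _)
  rw [← whiskerRight_gcomp, ← whiskerRight_gcomp, h, associator_naturality_middle_assoc,
    ← MonoidalCategory.whiskerLeft_comp_assoc]
  have e : (ρ_ X).inv ▷ (b ⟶[V] b') ≫ (α_ X (𝟙_ V) _).hom = X ◁ (λ_ _).inv := by simp
  rw [reassoc_of% e, ← MonoidalCategory.whiskerLeft_comp_assoc, e_id_comp,
    MonoidalCategory.whiskerLeft_id, Category.id_comp]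

theorem isNaturalFamily_gcomp_map (G : EnrichedFunctor V B C) {b : B} {c : C} {X : V}
    (s : X ⟶ (c ⟶[V] G.obj b)) :
    IsNaturalFamily (EnrichedFunctor.id V B) G b c (fun b' => gcomp s (G.map b b')) := by
  intro b' b''
  have e : gcomp (G.map b b') (G.map b' b'') =
      gcomp (𝟙 (b ⟶[V] b')) (𝟙 (b' ⟶[V] b'')) ≫ G.map b b'' := by
    rw [gcomp_map, Category.id_comp, Category.id_comp]
  exact (gcomp_assoc s (G.map b b') (G.map b' b'')).trans (congrArg ((α_ _ _ _).hom ≫ ·)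
    ((congrArg (gcomp s) e).trans (whiskerLeft_gcomp _ _ _).symm))

theorem ranLeg_idNatTrans (J : EnrichedFunctor V A B) (G : EnrichedFunctor V B C) (b : B) (a : A) :
    ranLeg (J := J) (R := G) (idNatTrans V (J.comp V G)) b a = G.map b (J.obj a) :=
  post_eId _

/-- If restriction along `J` is fully faithful on `V`-valued `V`-functors, every `G : B ⟶ C` is the
pointwise right Kan extension of `G J` along `J`: by the Yoneda lemma `C(c, G b)` is the object of
transformations from `B(b, -)` to `C(c, G -)`. -/
theorem isUniversalCounit_idNatTrans {J : EnrichedFunctor V A B} {G : EnrichedFunctor V B C}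
    (h : ∀ (b : B) (c : C), ExtendsWedges J (corep b) (G.comp V (corep c))) :
    IsUniversalCounit (J := J) (R := G) (idNatTrans V (J.comp V G)) := by
  intro b c X t ht
  simp only [ranLeg_idNatTrans]
  obtain ⟨k, ⟨hk, hkt⟩, hu⟩ := h b c _
    ((isWedge_comp_assoc_iff _ J G _ _).1 ((isWedge_corep_iff J (J.comp V G) b c t).2 ht))
  obtain ⟨T, rfl⟩ : ∃ T : ∀ b', X ⊗ (b ⟶[V] b') ⟶ (c ⟶[V] G.obj b'),
      (fun b' => MonoidalClosed.curry ((β_ (b ⟶[V] b') X).hom ≫ T b')) = k :=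
    ⟨fun b' => (β_ _ _).hom ≫ MonoidalClosed.uncurry (k b'),
      funext fun b' => curry_braiding_uncurry (k b')⟩
  have hT : IsNaturalFamily (EnrichedFunctor.id V B) G b c T :=
    (isWedge_corep_iff (EnrichedFunctor.id V B) G b c T).1 ((isWedge_id_comp_iff _ _ _).2 hk)
  refine ⟨(ρ_ X).inv ≫ X ◁ eId V b ≫ T b, fun a => ?_, fun s hs => ?_⟩
  · exact (hT.eq_gcomp_map (J.obj a)).trans (curry_braiding_injective (hkt a))
  · have hs' := hu (fun b' => MonoidalClosed.curry ((β_ (b ⟶[V] b') X).hom ≫ gcomp s (G.map b b')))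
      ⟨(isWedge_id_comp_iff _ _ _).1 ((isWedge_corep_iff (EnrichedFunctor.id V B) G b c _).2
        (isNaturalFamily_gcomp_map G s)),
        fun a => congrArg (fun z => MonoidalClosed.curry ((β_ _ _).hom ≫ z)) (hs a)⟩
    rw [← curry_braiding_injective (congrFun hs' b), whiskerLeft_gcomp, G.map_id, gcomp_eId,
      Iso.inv_hom_id_assoc]

end Transpose

/-! ### Ends in terms of wedges -/

section End

variable [MonoidalClosed V] [HasLimits V] {A : Type u} [EnrichedCategory V A]
  {B : Type w₂} [EnrichedCategory V B] {C : Type w₃} [EnrichedCategory V C]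

/-- A morphism into an end is invertible iff every wedge factors uniquely through it. -/
theorem isIso_natHom_iff {F G : EnrichedFunctor V A C} {P : V} (f : P ⟶ natHom F G) :
    IsIso f ↔ ∀ ⦃X : V⦄ (k : ∀ a, X ⟶ (F.obj a ⟶[V] G.obj a)), IsWedge F G k →
      ∃! x : X ⟶ P, ∀ a, x ≫ f ≫ natHomπ F G a = k a := by
  constructor
  · intro _ X k hk
    refine ⟨natHomLift k hk ≫ inv f, fun a => ?_, fun x hx => ?_⟩
    · rw [Category.assoc, IsIso.inv_hom_id_assoc, natHomLift_π]
    · rw [IsIso.eq_comp_inv]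
      exact natHom_ext fun a => by rw [Category.assoc, hx, natHomLift_π]
  · intro h
    obtain ⟨g, hg, -⟩ := h _ (natHomπ_isWedge F G)
    have hgf : g ≫ f = 𝟙 _ :=
      natHom_ext fun a => by rw [Category.assoc, hg, Category.id_comp]
    refine ⟨g, (h _ ((natHomπ_isWedge F G).precomp f)).unique (fun a => ?_) (fun a => ?_), hgf⟩
    · rw [Category.assoc, hg]
    · rw [Category.id_comp]

/-- The comparison with the end is invertible iff natural families factor uniquely through the
legs: its components are the transposes of the composites with the legs. -/
theorem isRightKan_iff {J : EnrichedFunctor V A B} {G : EnrichedFunctor V A C}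
    {R : EnrichedFunctor V B C} (ε : VNatTrans (J.comp V R) G) :
    IsRightKan J G R ε ↔ IsUniversalCounit ε := by
  have key (b : B) (c : C) {X : V} (x : X ⟶ (c ⟶[V] R.obj b)) (a : A) :
      x ≫ limitComparison (J.comp V (corep b)) G (R.obj b) (ranCone ε b) c ≫
        natHomπ (J.comp V (corep b)) (G.comp V (corep c)) a =
      MonoidalClosed.curry ((β_ (b ⟶[V] J.obj a) X).hom ≫ gcomp x (ranLeg ε b a)) := by
    refine (congrArg (x ≫ ·) (natHomLift_π _ _ a)).trans ?_
    refine (MonoidalClosed.curry_natural_left _ _).symm.trans (congrArg MonoidalClosed.curry ?_)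
    have e : MonoidalClosed.uncurry' ((ranCone ε b).app a) = ranLeg ε b a :=
      (MonoidalClosed.uncurry'_curry' _).trans (post_eq _ (counitApp ε a)).symm
    exact (congrArg (fun z => (b ⟶[V] J.obj a) ◁ x ≫ (β_ _ _).hom ≫ _ ◁ z ≫ eComp V c _ _) e).trans
      (by
        rw [BraidedCategory.braiding_naturality_right_assoc,
          ← MonoidalCategory.tensorHom_def_assoc]
        rfl)
  refine forall_congr' fun b => forall_congr' fun c => (isIso_natHom_iff _).trans
    ⟨fun h X t ht => ?_, fun h X k hk => ?_⟩
  · obtain ⟨x, hx, hu⟩ := h _ ((isWedge_corep_iff J G b c t).2 ht)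
    exact ⟨x, fun a => curry_braiding_injective ((key b c x a).symm.trans (hx a)), fun y hy =>
      hu y fun a => (key b c y a).trans
        (congrArg (fun z => MonoidalClosed.curry ((β_ _ _).hom ≫ z)) (hy a))⟩
  · obtain ⟨t, rfl⟩ : ∃ t : ∀ a, X ⊗ (b ⟶[V] J.obj a) ⟶ (c ⟶[V] G.obj a),
        (fun a => MonoidalClosed.curry ((β_ (b ⟶[V] J.obj a) X).hom ≫ t a)) = k :=
      ⟨fun a => (β_ _ _).hom ≫ MonoidalClosed.uncurry (k a),
        funext fun a => curry_braiding_uncurry (k a)⟩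
    obtain ⟨x, hx, hu⟩ := h t ((isWedge_corep_iff J G b c t).1 hk)
    exact ⟨x, fun a => (key b c x a).trans
      (congrArg (fun z => MonoidalClosed.curry ((β_ _ _).hom ≫ z)) (hx a)), fun y hy =>
      hu y fun a => curry_braiding_injective ((key b c y a).symm.trans (hy a))⟩

/-- `[J, C]` is invertible on the hom-object from `F` to `G` iff wedges extend uniquely along `J`.
-/
theorem isIso_restrict_iff {A B : Type u} [EnrichedCategory V A] [EnrichedCategory V B] 
    (J : EnrichedFunctor V A B) (F G : EnrichedFunctor V B C) :
    IsIso (restrict J F G) ↔ ExtendsWedges J F G := by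
  refine (isIso_natHom_iff _).trans
    (forall_congr' fun X => forall_congr' fun l => forall_congr' fun hl => ⟨?_, ?_⟩)
  · rintro ⟨x, hx, hu⟩
    have hx' (a : A) : x ≫ natHomπ F G (J.obj a) = l a :=
      (congrArg (x ≫ ·) (restrict_π J F G a)).symm.trans (hx a)
    refine ⟨fun b => x ≫ natHomπ F G b, ⟨(natHomπ_isWedge F G).precomp x, hx'⟩, ?_⟩
    rintro k ⟨hk, hkl⟩
    obtain rfl : natHomLift k hk = x :=
      hu _ fun a => (congrArg (_ ≫ ·) (restrict_π J F G a)).trans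
        ((natHomLift_π k hk _).trans (hkl a))
    exact funext fun b => (natHomLift_π k hk b).symm
  · rintro ⟨k, ⟨hk, hkl⟩, hu⟩
    refine ⟨natHomLift k hk, fun a => (congrArg (_ ≫ ·) (restrict_π J F G a)).trans
        ((natHomLift_π k hk _).trans (hkl a)), fun x hx => natHom_ext fun b => ?_⟩
    rw [natHomLift_π]
    exact congrFun (hu (fun b => x ≫ natHomπ F G b) ⟨(natHomπ_isWedge F G).precomp x, fun a =>
      (congrArg (x ≫ ·) (restrict_π J F G a)).symm.trans (hx a)⟩) b

end End

/-! ### Preservation of right Kan extensions -/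

section Preservation

variable {A : Type w₁} [EnrichedCategory V A] {B : Type w₂} [EnrichedCategory V B]
  {C : Type w₃} [EnrichedCategory V C] {D : Type w₄} [EnrichedCategory V D]

theorem post_eq_eId_of_comp_eq {x y : C} {f : 𝟙_ V ⟶ (x ⟶[V] y)} {g : 𝟙_ V ⟶ (y ⟶[V] x)}
    (h : (λ_ (𝟙_ V)).inv ≫ (f ⊗ₘ g) ≫ eComp V x y x = eId V x) : post f g = eId V x := by
  rw [post, ← unitors_inv_equal]
  exact h

theorem gcomp_post_of_gcomp_eq {c x y z : C} {X Q : V} (s : X ⟶ (c ⟶[V] x))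
    {σ : 𝟙_ V ⟶ (x ⟶[V] y)} {g : Q ⟶ (y ⟶[V] z)} {g' : Q ⟶ (x ⟶[V] z)}
    (h : gcomp σ g = gcomp (eId V x) g') : gcomp (post s σ) g = gcomp s g' := by
  rw [gcomp_post_left, h, eId_gcomp, Iso.inv_hom_id_assoc]

theorem ranLeg_whiskerCounit {J : EnrichedFunctor V A B} {G : EnrichedFunctor V A D}
    {R : EnrichedFunctor V B D} (ε : VNatTrans (J.comp V R) G) (F : EnrichedFunctor V D C)
    (b : B) (a : A) :
    ranLeg (ε.whiskerCounit F) b a = ranLeg ε b a ≫ F.map (R.obj b) (G.obj a) :=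
  (post_map F (R.map b (J.obj a)) (counitApp ε a)).symm

/-- Whether `F` preserves a right Kan extension does not depend on the choice of the latter, by
uniqueness of weighted limits. -/
theorem IsUniversalCounit.whiskerCounit_of {J : EnrichedFunctor V A B} {G : EnrichedFunctor V A D}
    {R R' : EnrichedFunctor V B D} {ε : VNatTrans (J.comp V R) G} {ε' : VNatTrans (J.comp V R') G}
    (hε : IsUniversalCounit ε) (hε' : IsUniversalCounit ε') {F : EnrichedFunctor V D C}
    (h : IsUniversalCounit (ε'.whiskerCounit F)) : IsUniversalCounit (ε.whiskerCounit F) := by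
  intro b c X t ht
  obtain ⟨σ, hσ, -⟩ := hε b (R'.obj b) _ (isNaturalFamily_gcomp_ranLeg ε' (eId V (R'.obj b)))
  obtain ⟨τ, hτ, -⟩ := hε' b (R.obj b) _ (isNaturalFamily_gcomp_ranLeg ε (eId V (R.obj b)))
  have hστ : post τ σ = eId V (R.obj b) := hε.hom_ext fun a => by
    rw [gcomp_post_of_gcomp_eq τ (hσ a), hτ]
  have hFσ (a : A) : gcomp (σ ≫ F.map _ _) (ranLeg ε b a ≫ F.map _ _) =
      gcomp (eId V (F.obj (R'.obj b))) (ranLeg ε' b a ≫ F.map _ _) := by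
    rw [← gcomp_map, hσ, gcomp_map, F.map_id]
  have hFτ (a : A) : gcomp (τ ≫ F.map _ _) (ranLeg ε' b a ≫ F.map _ _) =
      gcomp (eId V (F.obj (R.obj b))) (ranLeg ε b a ≫ F.map _ _) := by
    rw [← gcomp_map, hτ, gcomp_map, F.map_id]
  obtain ⟨s, hs, hu⟩ := h b c t ht
  simp only [ranLeg_whiskerCounit] at hs hu ⊢
  refine ⟨post s (σ ≫ F.map _ _), fun a => ?_, fun s' hs' => ?_⟩
  · exact (gcomp_post_of_gcomp_eq s (hFσ a)).trans (hs a)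
  · obtain rfl : post s' (τ ≫ F.map _ _) = s :=
      hu _ fun a => (gcomp_post_of_gcomp_eq s' (hFτ a)).trans (hs' a)
    have e : post (τ ≫ F.map _ _) (σ ≫ F.map _ _) = eId V (F.obj (R.obj b)) := by
      rw [← post_map, hστ, F.map_id]
    exact ((post_post _ _ _).trans ((congrArg (post s') e).trans (post_eId _))).symm

/-- If a right Kan extension of `J` along itself is isomorphic to the identity and preserved by `F`,
then wedges into `F J` extend uniquely along `J`. -/
theorem IsUniversalCounit.extendsWedges_of_isNatIso {J : EnrichedFunctor V A B}
    {R : EnrichedFunctor V B B} {ε : VNatTrans (J.comp V R) J}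
    {α : VNatTrans R (EnrichedFunctor.id V B)} (hα : IsNatIso α) {F : EnrichedFunctor V B C}
    (hF : IsUniversalCounit (ε.whiskerCounit F)) (H : EnrichedFunctor V B C) :
    ExtendsWedges J H F := by
  obtain ⟨β, hαβ⟩ := hα
  let α' (b : B) : 𝟙_ V ⟶ (F.obj (R.obj b) ⟶[V] F.obj b) := α.app b ≫ F.map (R.obj b) b
  let β' (b : B) : 𝟙_ V ⟶ (F.obj b ⟶[V] F.obj (R.obj b)) := β.app b ≫ F.map b (R.obj b)
  let ε' (a : A) : 𝟙_ V ⟶ (F.obj (R.obj (J.obj a)) ⟶[V] F.obj (J.obj a)) :=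
    counitApp ε a ≫ F.map (R.obj (J.obj a)) (J.obj a)
  have hα' : IsWedge (R.comp V F) F α' := (isWedge_comp_id_iff _ _ _).1 (α.isWedge.map F)
  have hβ' : IsWedge F (R.comp V F) β' := (isWedge_id_comp_iff _ _ _).1 (β.isWedge.map F)
  have hε' : IsWedge (J.comp V (R.comp V F)) (J.comp V F) ε' := (ε.whiskerCounit F).isWedge
  have hα'β' (b : B) : post (α' b) (β' b) = eId V (F.obj (R.obj b)) := by
    refine (post_map F (α.app b) (β.app b)).symm.trans ?_
    rw [post_eq_eId_of_comp_eq (hαβ b).1, F.map_id]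
  have hβ'α' (b : B) : post (β' b) (α' b) = eId V (F.obj b) :=
    (post_map F (β.app b) (α.app b)).symm.trans
      ((congrArg (· ≫ _) (post_eq_eId_of_comp_eq (hαβ b).2)).trans (F.map_id b))
  have univ {H : EnrichedFunctor V B C} {X : V}
      {l : ∀ a, X ⟶ (H.obj (J.obj a) ⟶[V] F.obj (J.obj a))}
      (hl : IsWedge (J.comp V H) (J.comp V F) l) :
      ∃! k : ∀ b, X ⟶ (H.obj b ⟶[V] F.obj (R.obj b)),
        IsWedge H (R.comp V F) k ∧ ∀ a, post (k (J.obj a)) (ε' a) = l a :=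
    hF.existsUnique_isWedge hl
  let θ (a : A) : 𝟙_ V ⟶ (F.obj (J.obj a) ⟶[V] F.obj (J.obj a)) := post (β' (J.obj a)) (ε' a)
  have hθ : IsWedge (J.comp V F) (J.comp V F) θ := (hβ'.restrict J).post hε'
  -- The universal property yields a one-sided inverse `τ` of `θ`. It extends to all of `B`, so it
  -- is natural with respect to the morphisms that `θ` comes from, and is a two-sided inverse.
  obtain ⟨k₀, ⟨hk₀, hk₀ε⟩, -⟩ := univ (IsWedge.id (J.comp V F))
  let τ (b : B) : 𝟙_ V ⟶ (F.obj b ⟶[V] F.obj b) := post (k₀ b) (α' b)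
  have hτ : IsWedge F F τ := hk₀.post hα'
  have cancel {X : V} {x : C} {a : A} (f : X ⟶ (x ⟶[V] F.obj (R.obj (J.obj a)))) :
      post (post f (α' (J.obj a))) (θ a) = post f (ε' a) := by
    rw [post_post, ← post_post (α' (J.obj a)), hα'β', eId_post]
  have hτθ (a : A) : post (τ (J.obj a)) (θ a) = eId V (F.obj (J.obj a)) :=
    (cancel _).trans (hk₀ε a)
  have hθτ (a : A) : post (θ a) (τ (J.obj a)) = eId V (F.obj (J.obj a)) := by
    rw [← hτθ]
    have e : θ a = post (β.app (J.obj a)) (counitApp ε a) ≫ F.map (J.obj a) (J.obj a) :=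
      (post_map F (β.app (J.obj a)) (counitApp ε a)).symm
    rw [e]
    exact hτ.post_map_comm _
  intro X l hl
  obtain ⟨k, ⟨hk, hkl⟩, hu⟩ := univ (hl.post hθ)
  replace hkl : ∀ a, post (k (J.obj a)) (ε' a) = post (l a) (θ a) := hkl
  refine ⟨fun b => post (k b) (α' b), ⟨hk.post hα', fun a => ?_⟩, fun k' hk' => funext fun b => ?_⟩
  · have h := congrArg (fun z => post z (τ (J.obj a))) ((cancel _).trans (hkl a))
    rwa [post_post _ (θ a), post_post _ (θ a), hθτ, post_eId, post_eId] at h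
  · rw [← congrFun (hu (fun b => post (k' b) (β' b)) ⟨hk'.1.post hβ', fun a => ?_⟩) b, post_post,
      hβ'α', post_eId]
    exact (post_post _ _ _).trans (congrArg (post · (θ a)) (hk'.2 a))

end Preservation

/-! ### The identity as a Kan extension -/

section Identity

variable {A : Type w₁} [EnrichedCategory V A] {B : Type w₂} [EnrichedCategory V B]
  {C : Type w₃} [EnrichedCategory V C]

theorem comp_id_eq (F : EnrichedFunctor V A B) : F.comp V (EnrichedFunctor.id V B) = F :=
  EnrichedFunctor.ext V (fun _ => rfl) fun a a' =>
    (Category.comp_id (F.map a a' ≫ 𝟙 _)).trans (Category.comp_id _)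

theorem id_comp_eq (F : EnrichedFunctor V B C) : (EnrichedFunctor.id V B).comp V F = F :=
  EnrichedFunctor.ext V (fun _ => rfl) fun b b' =>
    (Category.comp_id (𝟙 _ ≫ F.map b b')).trans (Category.id_comp _)

/-- The canonical isomorphism `Id J ⟶ J`. -/
def idCompCounit (J : EnrichedFunctor V A B) :
    VNatTrans (J.comp V (EnrichedFunctor.id V B)) J where
  app a := eId V (J.obj a)
  naturality a a' := (congrArg (fun z => (ρ_ _).inv ≫ (z ⊗ₘ _) ≫ _) (Category.comp_id _)).trans
    ((idNatTrans V J).naturality a a')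

/-- The canonical isomorphism `J ⟶ Id J`. -/
def idCompUnit (J : EnrichedFunctor V A B) :
    VNatTrans J (J.comp V (EnrichedFunctor.id V B)) where
  app a := eId V (J.obj a)
  naturality a a' := ((idNatTrans V J).naturality a a').trans
    (congrArg (fun z => (λ_ _).inv ≫ (_ ⊗ₘ z) ≫ _) (Category.comp_id (J.map a a'))).symm

theorem isNatIso_idNatTrans (F : EnrichedFunctor V A C) : IsNatIso (idNatTrans V F) := by
  have h (a : A) : (λ_ (𝟙_ V)).inv ≫ (eId V (F.obj a) ⊗ₘ eId V (F.obj a)) ≫ eComp V _ _ _ =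
      eId V (F.obj a) := by
    rw [unitors_inv_equal]
    exact eId_post _
  exact ⟨idNatTrans V F, fun a => ⟨h a, h a⟩⟩

/-- A counit `G J ⟶ K` whose components are identities is universal as soon as the identity of
`G J` is. -/
theorem IsUniversalCounit.of_eq {J : EnrichedFunctor V A B} {G : EnrichedFunctor V B C}
    {K : EnrichedFunctor V A C} (e : K = J.comp V G) {ε : VNatTrans (J.comp V G) K}
    (hε : ∀ a, ε.app a ≍ eId V (G.obj (J.obj a)))
    (h : IsUniversalCounit (J := J) (R := G) (idNatTrans V (J.comp V G))) :
    IsUniversalCounit ε := by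
  subst e
  obtain rfl : ε = idNatTrans V (J.comp V G) := by
    obtain ⟨app, _⟩ := ε
    obtain rfl : app = fun a => eId V (G.obj (J.obj a)) := funext fun a => eq_of_heq (hε a)
    rfl
  exact h

end Identity

/-! ### Duality -/

section Duality

open Opposite

variable {A : Type w₁} [EnrichedCategory V A] {B : Type w₂} [EnrichedCategory V B]
  {C : Type w₃} [EnrichedCategory V C]

/-- The `V`-functor `A ⟶ Cᵒᵖ` corresponding to a `V`-functor `Aᵒᵖ ⟶ C`. -/
def rightOpFunctor (F : EnrichedFunctor V Aᵒᵖ C) : EnrichedFunctor V A Cᵒᵖ where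
  obj a := op (F.obj (op a))
  map a a' := F.map (op a') (op a)
  map_id a := F.map_id (op a)
  map_comp a a' a'' := by
    refine Eq.trans ?_ (tensorHom_eComp_op_eq V (C := C) (z := op (F.obj (op a)))
      (y := op (F.obj (op a'))) (x := op (F.obj (op a''))) _ _).symm
    refine Eq.trans ?_ (congrArg _ (F.map_comp (op a'') (op a') (op a)))
    rw [eComp_op_eq, Category.assoc, SymmetricCategory.symmetry_assoc]

/-- The two sides of the wedge condition are interchanged by passing to the opposite `V`-category.
-/
theorem op_wedge_condition_iff {x y z w : C} {X H : V} (f : H ⟶ (x ⟶[V] y)) (k : X ⟶ (y ⟶[V] w))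
    (k' : X ⟶ (x ⟶[V] z)) (g : H ⟶ (z ⟶[V] w)) :
    (β_ X H).hom ≫ gcomp (x := op w) (y := op z) (z := op x) g k' =
      gcomp (x := op w) (y := op y) (z := op x) k f ↔
    (β_ X H).hom ≫ gcomp f k = gcomp k' g := by
  unfold gcomp
  rw [tensorHom_eComp_op_eq, tensorHom_eComp_op_eq, SymmetricCategory.symmetry_assoc]
  exact eq_comm

theorem isWedge_opFunctor_iff (F G : EnrichedFunctor V A C) {X : V}
    (k : ∀ a, X ⟶ (F.obj a ⟶[V] G.obj a)) :
    IsWedge (opFunctor G) (opFunctor F) (fun a => k a.unop) ↔ IsWedge F G k :=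
  ⟨fun h a a' => (op_wedge_condition_iff _ _ _ _).1 (h (op a') (op a)),
    fun h a a' => (op_wedge_condition_iff _ _ _ _).2 (h a'.unop a.unop)⟩

theorem isWedge_rightOpFunctor_iff (F G : EnrichedFunctor V Aᵒᵖ C) {X : V}
    (k : ∀ a, X ⟶ (F.obj a ⟶[V] G.obj a)) :
    IsWedge (rightOpFunctor G) (rightOpFunctor F) (fun a => k (op a)) ↔ IsWedge F G k :=
  ⟨fun h a a' => (op_wedge_condition_iff _ _ _ _).1 (h a'.unop a.unop),
    fun h a a' => (op_wedge_condition_iff _ _ _ _).2 (h (op a') (op a))⟩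

theorem ExtendsWedges.of_opFunctor {J : EnrichedFunctor V A B} {F G : EnrichedFunctor V B C}
    (h : ExtendsWedges (opFunctor J) (opFunctor G) (opFunctor F)) : ExtendsWedges J F G := by
  intro X l hl
  obtain ⟨k, ⟨hk, hkl⟩, hu⟩ := h (fun a => l a.unop) 
    ((isWedge_opFunctor_iff (J.comp V F) (J.comp V G) l).2 hl)
  refine ⟨fun b => k (op b), ⟨(isWedge_opFunctor_iff _ _ _).1 hk, fun a => hkl (op a)⟩, ?_⟩
  rintro k' ⟨hk', hkl'⟩
  have := hu (fun b => k' b.unop) ⟨(isWedge_opFunctor_iff _ _ k').2 hk', fun a => hkl' a.unop⟩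
  exact funext fun b => congrFun this (op b)

theorem ExtendsWedges.of_rightOpFunctor {J : EnrichedFunctor V A B}
    {F G : EnrichedFunctor V Bᵒᵖ C}
    (h : ExtendsWedges J (rightOpFunctor G) (rightOpFunctor F)) :
    ExtendsWedges (opFunctor J) F G := by
  intro X l hl
  obtain ⟨k, ⟨hk, hkl⟩, hu⟩ := h (fun a => l (op a))
    ((isWedge_rightOpFunctor_iff ((opFunctor J).comp V F) ((opFunctor J).comp V G) l).2 hl)
  refine ⟨fun b => k b.unop, ⟨(isWedge_rightOpFunctor_iff _ _ _).1 hk, fun a => hkl a.unop⟩, ?_⟩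
  rintro k' ⟨hk', hkl'⟩
  have := hu (fun b => k' (op b)) ⟨(isWedge_rightOpFunctor_iff _ _ k').2 hk', fun a => hkl' (op a)⟩
  exact funext fun b => congrFun this b.unop

theorem isNatIso_opNatTrans {F G : EnrichedFunctor V A C} {α : VNatTrans F G} {β : VNatTrans G F}
    (h : ∀ a : A,
      (λ_ (𝟙_ V)).inv ≫ (α.app a ⊗ₘ β.app a) ≫ eComp V _ _ _ = eId V (F.obj a) ∧
      (λ_ (𝟙_ V)).inv ≫ (β.app a ⊗ₘ α.app a) ≫ eComp V _ _ _ = eId V (G.obj a)) :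
    IsNatIso (opNatTrans β) := by
  have key {x y : C} (f : 𝟙_ V ⟶ (x ⟶[V] y)) (g : 𝟙_ V ⟶ (y ⟶[V] x)) :
      (λ_ (𝟙_ V)).inv ≫ gcomp (x := op x) (y := op y) (z := op x) g f =
        (λ_ (𝟙_ V)).inv ≫ gcomp f g := by
    unfold gcomp
    rw [tensorHom_eComp_op_eq, leftUnitor_inv_braiding_assoc, ← unitors_inv_equal]
  exact ⟨opNatTrans α, fun a => ⟨(key _ _).trans (h a.unop).1, (key _ _).trans (h a.unop).2⟩⟩

end Duality

/-! ### Large codomains -/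

section Small

/-- The full `V`-subcategory on a family of objects. -/
abbrev inducedEnrichedCategory {C : Type w₁} [EnrichedCategory V C] {S : Type w₂} (p : S → C) :
    EnrichedCategory V S where
  Hom s t := p s ⟶[V] p t
  id s := eId V (p s)
  comp s t r := eComp V (p s) (p t) (p r)
  id_comp s t := e_id_comp V (p s) (p t)
  comp_id s t := e_comp_id V (p s) (p t)
  assoc s t r q := e_assoc V (p s) (p t) (p r) (p q)

variable [MonoidalClosed V] [HasLimits V] {A B : Type u} [EnrichedCategory V A]
  [EnrichedCategory V B]

/-- The targets may be large: two `V`-functors on a small `V`-category factor through a small full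
subcategory of their codomain. -/
theorem IsVLaxEpi.extendsWedges {J : EnrichedFunctor V A B} (hJ : IsVLaxEpi J) {C : Type w₁}
    [EnrichedCategory V C] (F G : EnrichedFunctor V B C) : ExtendsWedges J F G := by
  let _ : EnrichedCategory V (B ⊕ B) := inducedEnrichedCategory (Sum.elim F.obj G.obj)
  let F' : EnrichedFunctor V B (B ⊕ B) :=
    { obj := Sum.inl, map := F.map, map_id := F.map_id, map_comp := F.map_comp }
  let G' : EnrichedFunctor V B (B ⊕ B) :=
    { obj := Sum.inr, map := G.map, map_id := G.map_id, map_comp := G.map_comp }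
  exact (isIso_restrict_iff J F' G').1 (hJ (B ⊕ B) F' G')

end Small

/-! ### Lax epimorphisms, density and codensity -/

section Main

variable [MonoidalClosed V] [HasLimits V] {A B : Type u} [EnrichedCategory V A]
  [EnrichedCategory V B] {C : Type w₃} [EnrichedCategory V C]

/-- Full faithfulness of restriction on `V`-valued `V`-functors implies it for all codomains: every
`V`-functor on `B` is then a right Kan extension of its restriction. -/
theorem isVLaxEpi_of_extendsWedges {J : EnrichedFunctor V A B}
    (h : ∀ F G : EnrichedFunctor V B V, ExtendsWedges J F G) : IsVLaxEpi J := fun _ _ F _ =>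
  (isIso_restrict_iff J _ _).2 ((isUniversalCounit_idNatTrans fun _ _ => h _ _).extendsWedges F)

theorem isRightKan_idCompCounit {J : EnrichedFunctor V A B}
    (h : ∀ F G : EnrichedFunctor V B V, ExtendsWedges J F G) :
    IsRightKan J J (EnrichedFunctor.id V B) (idCompCounit J) :=
  (isRightKan_iff _).2 (IsUniversalCounit.of_eq (comp_id_eq J).symm (fun _ => HEq.rfl)
    (isUniversalCounit_idNatTrans fun _ _ => h _ _))

theorem isRightKan_whiskerCounit {J : EnrichedFunctor V A B}
    (h : ∀ F G : EnrichedFunctor V B V, ExtendsWedges J F G) {R : EnrichedFunctor V B B}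
    {ε : VNatTrans (J.comp V R) J} (hε : IsRightKan J J R ε) (F : EnrichedFunctor V B C) :
    IsRightKan J (J.comp V F) (R.comp V F) (ε.whiskerCounit F) := by
  refine (isRightKan_iff _).2 (((isRightKan_iff _).1 hε).whiskerCounit_of
    ((isRightKan_iff _).1 (isRightKan_idCompCounit h)) (IsUniversalCounit.of_eq
      (J := J) (congrArg (EnrichedFunctor.comp V J) (id_comp_eq F).symm)
      (fun a => heq_of_eq (F.map_id (J.obj a))) (isUniversalCounit_idNatTrans fun _ _ => h _ _)))

theorem isAbsolutelyVCodense_iff (J : EnrichedFunctor V A B) :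
    IsAbsolutelyVCodense J ↔ ∀ F G : EnrichedFunctor V B V, ExtendsWedges J F G := by
  constructor
  · rintro ⟨⟨R, ε, hε, α, hα⟩, hpres⟩ F G
    exact IsUniversalCounit.extendsWedges_of_isNatIso hα ((isRightKan_iff _).1 (hpres R ε hε G)) F
  · exact fun h => ⟨⟨_, _, isRightKan_idCompCounit h, _, isNatIso_idNatTrans _⟩,
      fun R ε hε F => isRightKan_whiskerCounit h hε F⟩

/-- The argument for codensity, applied to `Jᵒᵖ` and to `V`-functors `Fᵒᵖ : Bᵒᵖ ⟶ Vᵒᵖ`. -/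
theorem IsAbsolutelyVDense.extendsWedges {J : EnrichedFunctor V A B} (h : IsAbsolutelyVDense J)
    (F G : EnrichedFunctor V B V) : ExtendsWedges J F G := by
  obtain ⟨⟨L, η, hη, α, β, hαβ⟩, hpres⟩ := h
  exact ExtendsWedges.of_opFunctor (IsUniversalCounit.extendsWedges_of_isNatIso
    (J := opFunctor J) (R := opFunctor L) (F := opFunctor F) (ε := opNatTrans η)
    (isNatIso_opNatTrans hαβ) ((isRightKan_iff _).1 (hpres L η hη F)) _)

/-- A left Kan extension along `J` is a right Kan extension along `Jᵒᵖ`; its preservation concerns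
`V`-functors `Bᵒᵖ ⟶ Vᵒᵖ`, which is why codomains other than `V` are needed. -/
theorem isAbsolutelyVDense_of_extendsWedges {J : EnrichedFunctor V A B}
    (h : ∀ F G : EnrichedFunctor V Bᵒᵖ V, ExtendsWedges (opFunctor J) F G) :
    IsAbsolutelyVDense J :=
  ⟨⟨EnrichedFunctor.id V B, idCompUnit J, isRightKan_idCompCounit h, _, isNatIso_idNatTrans _⟩,
    fun L η hη F => isRightKan_whiskerCounit (R := opFunctor L) (ε := opNatTrans η) h hη
      (opFunctor F)⟩

end Main

end VCat

end

theorem theorem5 {V : Type v} [Category.{u} V] [MonoidalCategory V] [SymmetricCategory V]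
    [MonoidalClosed V] [HasLimits V] [HasColimits V]
    {A B : Type u} [EnrichedCategory V A] [EnrichedCategory V B] (J : EnrichedFunctor V A B) :
    List.TFAE [VCat.IsVLaxEpi J, VCat.IsAbsolutelyVDense J, VCat.IsAbsolutelyVCodense J] := by
  have codense := VCat.isAbsolutelyVCodense_iff J
  tfae_have 1 → 2 := fun h => VCat.isAbsolutelyVDense_of_extendsWedges fun F G =>
    VCat.ExtendsWedges.of_rightOpFunctor (h.extendsWedges _ _)
  tfae_have 2 → 1 := fun h => VCat.isVLaxEpi_of_extendsWedges h.extendsWedges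
  tfae_have 1 ↔ 3 := ⟨fun h => codense.2 fun F G => h.extendsWedges F G,
    fun h => VCat.isVLaxEpi_of_extendsWedges (codense.1 h)⟩
  tfae_finish
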